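/- **ADOPT converges to an optimal attribute order.** *Query.* A join query has a nonempty finite set $A$ of join attributes, finite relations over subsets of $A$, possibly further join predicates over subsets of $A$, and for each attribute a nonempty integer value range. Two attributes *connect* if they occur in a common relation or predicate; the query is assumed connected. The search space consists of the orders of $A$ in which each attribute after the first connects to an earlier one. Cubes are products of integer intervals, written half-open as $[l_i,u_i)$, with $\mathrm{Volume}(c)=\prod_i(u_i-l_i)$. *Execution of an order $o$.* There are $n\ge 1$ threads and a budget of $b\ge 1$ steps per thread and episode. The set $U$ of unprocessed cubes is initially the cube of all value ranges, split evenly (up to rounding) along a widest attribute into $n$ cubes, empty ones being dropped. In an episode, as long as some thread has budget left and unretrieved cubes remain, the thread with most budget left retrieves a uniformly random unretrieved cube $c$ of $U$. It runs the trie join with order $o$ inside $c$: attributes are fixed in the order $o$, each running in increasing order through the values in its range for which every relation containing it has a row agreeing with all values fixed so far, and which satisfy every predicate whose attributes are then all fixed. Each recursive invocation is one step; after each value has been handled, the join stops if its number of steps exceeds the thread's remaining budget. If the join stops with a timeout after completing the value combination $(v_0,\dots,v_k)$ of the first $k+1$ attributes of $o$, the processed cubes are, for $i\le k$, those with the first $i$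 attributes fixed to $v_0,\dots,v_{i-1}$, the next one below $v_i$ (up to and including $v_k$ if $i=k$), and the others unrestricted in $c$; the complementary cubes, with the next attribute above $v_i$, become unprocessed cubes for the following episodes (if nonempty). If there is no timeout, $c$ is processed completely. The reward of an episode is the total volume of the processed cubes divided by the volume of the query. Processing ends when $U=\emptyset$. Let $e_o$ be the expected number of episodes when only $o$ is used. The *average reward per episode* $r_o$ is the expected total reward over these episodes divided by $e_o$. The number of computational steps per episode is taken to be the constant $nb$, so the (expected) *number of processing steps* of $o$ is $n\,b\,e_o$. An order in the search space is *optimal* if it minimizes this number over the search space. *Learning.* ADOPT chooses orders by UCT with an exploration constant $C>0$. States are prefixes of orders, and the search tree initially consists of the root (the empty prefix). In each episode $t=0,1,2,\dots$ it builds a complete order attribute by attribute. At a prefix $p$, if some admissible successors $pa$ have no tree node, it moves to one of them (chosen arbitrarily, e.g. at random). Otherwise it moves to a successor maximizing $\bar X_{pa}+C\sqrt{\ln N_p/N_{pa}}$, where $N$ and $\bar X$ are the number and the mean of the rewards recorded at a node. Then a node is added for the first prefix of the selected order without a node (if any), and the reward is recorded at all nodes on the path, including the new one. Rewards are random as in the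 Markov decision process underlying ADOPT: for each order $o$ of the search space, the rewards of its successive executions are independent, identically distributed, $[0,1]$-valued random variables with expectation $r_o$. The learning process is considered over an unbounded number of episodes. *Claim.* Almost surely, 1. the fraction of the first $T$ episodes in which the selected order is optimal (i.e. minimizes the number of processing steps) tends to $1$ as $T\to\infty$; and 2. for all sufficiently large $T$, every order that is best according to the search tree after $T$ episodes (at each prefix it continues with an admissible successor of maximal mean reward) is optimal. -/

import Mathlib

open MeasureTheory ProbabilityTheory Filter Topology
open scoped ENNReal NNReal

namespace Adopt

variable {A : Type*} [Fintype A] [DecidableEq A]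

/-! ### Queries and cubes -/

/-- An input relation (after unary filters): a finite table over the join attributes in `scope`. -/
structure Rel (A : Type*) where
  scope : Finset A
  rows : Finset (scope → ℤ)

/-- A further (non-equality) join predicate, referring to the attributes in `scope`. -/
structure Pred (A : Type*) where
  scope : Finset A
  holds : (scope → ℤ) → Prop

/-- A join query over the join attributes `A`: it joins `rels` on equal attributes, subject to
`preds`. The values of attribute `a` range over the nonempty integer interval
`lo a ≤ v < hi a`. -/
structure Query (A : Type*) where
  rels : List (Rel A)
  preds : List (Pred A)
  lo : A → ℤ
  hi : A → ℤ
  lo_lt_hi : ∀ a, lo a < hi a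

/-- A cube: the product over all attributes of the integer intervals `lo a ≤ v < hi a`. Bounds are
half-open, so a closed integer range `[l, u]` is written with `hi = u + 1`. -/
@[ext] structure Cube (A : Type*) where
  lo : A → ℤ
  hi : A → ℤ

/-- `Volume(c) = ∏ᵢ (c.uᵢ - c.lᵢ)`; for half-open integer ranges, the number of value vectors. -/
def Cube.volume (c : Cube A) : ℕ := ∏ a, (c.hi a - c.lo a).toNat

/-- Replace the range of attribute `a` by `l ≤ v < h`. -/
def Cube.restrict (c : Cube A) (a : A) (l h : ℤ) : Cube A :=
  ⟨Function.update c.lo a l, Function.update c.hi a h⟩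

/-- The cube spanned by the value ranges of all join attributes of the query. -/
def Query.cube (q : Query A) : Cube A := ⟨q.lo, q.hi⟩

/-! ### Join processing of one cube -/

/-- `v` is produced by the iterator of the trie join for attribute `a`, when exactly the attributes
in `F` are fixed already, to the values `M`: each relation with attribute `a` has a row that agrees
with `M` on its fixed attributes and has value `v` at `a`, and all join predicates that refer to
`a` and otherwise only to fixed attributes are satisfied. -/
def Query.Matches (q : Query A) (F : Finset A) (M : A → ℤ) (a : A) (v : ℤ) : Prop :=
  (∀ R ∈ q.rels, a ∈ R.scope → ∃ row ∈ R.rows, ∀ x : R.scope,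
      (x.1 = a → row x = v) ∧ (x.1 ≠ a → x.1 ∈ F → row x = M x.1)) ∧
  (∀ P ∈ q.preds, a ∈ P.scope → P.scope ⊆ insert a F →
      P.holds (fun x => Function.update M a v x.1))

open Classical in
/-- The matching values for attribute `a` inside the target cube, in increasing order. -/
noncomputable def Query.values (q : Query A) (c : Cube A) (F : Finset A) (M : A → ℤ) (a : A) :
    List ℤ :=
  ((Finset.Ico (c.lo a) (c.hi a)).filter (q.Matches F M a)).sort (· ≤ ·)

/-- The loop over the values of one attribute: handle each value by the recursive call `f`, and
break as soon as the total number of steps exceeds the budget `b`. The state is the number of steps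
made so far. The result is the number of steps and, if the loop was left by a break, the values
last considered for the current and the following attributes, up to the attribute at which the
timeout was noticed (whose last value has then been considered completely). -/
def scan (b : ℕ) (f : ℤ → ℕ → ℕ × Option (List ℤ)) : List ℤ → ℕ → ℕ × Option (List ℤ)
  | [], s => (s, none)
  | v :: vs, s =>
    match f v s with
    | (s', some w) => (s', some (v :: w))
    | (s', none) => if b < s' then (s', some [v]) else scan b f vs s'

/-- The recursive join with timeout (the list is what remains of the attribute order). Every
invocation counts as one computational step. Output tuples are not recorded, since only progress
matters here. -/
noncomputable def joinRec (q : Query A) (b : ℕ) (c : Cube A) :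
    List A → Finset A → (A → ℤ) → ℕ → ℕ × Option (List ℤ)
  | [], _, _, s => (s + 1, none)
  | a :: o, F, M, s =>
    scan b (fun v s' => joinRec q b c o (insert a F) (Function.update M a v) s')
      (q.values c F M a) (s + 1)

/-- Cubes processed by a join over `c` that was stopped at the given values: for each attribute, the
previous attributes are fixed to their last values, the attribute runs over the values below its
last value (including the last value for the final attribute of the list, as this value has been
considered completely), the later ones over their full range. -/
def processed : List A → List ℤ → Cube A → List (Cube A)
  | a :: _, [v], c => [c.restrict a (c.lo a) (v + 1)]
  | a :: o, v :: w :: vs, c =>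
    c.restrict a (c.lo a) v :: processed o (w :: vs) (c.restrict a v (v + 1))
  | _, _, _ => []

/-- The complementary unprocessed cubes: previous attributes are fixed to their last values, the
attribute runs over the values above its last value, the later ones over their full range. -/
def unprocessed : List A → List ℤ → Cube A → List (Cube A)
  | a :: o, v :: vs, c =>
    c.restrict a (v + 1) (c.hi a) :: unprocessed o vs (c.restrict a v (v + 1))
  | _, _, _ => []

/-- The outcome of processing one target cube. -/
structure Outcome (A : Type*) where
  /-- the processed cubes -/
  done : List (Cube A)
  /-- the nonempty remaining cubes -/
  left : List (Cube A)
  /-- the number of computational steps -/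
  steps : ℕ

/-- Process the target cube `c` with attribute order `o` under the remaining budget `b`. -/
noncomputable def joinOneCube (q : Query A) (b : ℕ) (o : List A) (c : Cube A) : Outcome A :=
  match joinRec q b c o ∅ (fun _ => 0) 0 with
  | (s, none) => ⟨[c], [], s⟩
  | (s, some vs) => ⟨processed o vs c, (unprocessed o vs c).filter (fun u => 0 < u.volume), s⟩

/-! ### Task manager, episodes, rewards -/

/-- An attribute with the largest value range. -/
noncomputable def Query.widest [Nonempty A] (q : Query A) : A :=
  Classical.choose (Finset.exists_max_image Finset.univ (fun a => q.hi a - q.lo a)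
    Finset.univ_nonempty)

/-- The initial unprocessed cubes: the range of the widest attribute is divided (up to rounding)
equally among the `n` threads; empty shares are dropped. -/
noncomputable def Query.initCubes [Nonempty A] (q : Query A) (n : ℕ) : Multiset (Cube A) :=
  let a := q.widest
  let cut : ℕ → ℤ := fun i => q.lo a + (i * (q.hi a - q.lo a)) / n
  ((Multiset.range n).map (fun i => q.cube.restrict a (cut i) (cut (i + 1)))).filter
    (fun c => 0 < c.volume)

/-- `Reward(P, q)`: the volume of the processed cubes, scaled to the volume of the query. -/
noncomputable def reward (q : Query A) (P : List (Cube A)) : ℝ≥0 :=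
  ((P.map Cube.volume).sum : ℝ≥0) / q.cube.volume

open Classical in
/-- The parallel loop of one episode. `pool` holds the unprocessed cubes not yet retrieved, `budgets`
the remaining budgets of the threads, `left` the unprocessed parts of the target cubes on which a
thread ran out of budget (available again after the episode), `r` the accumulated reward. Steps take
unit time on each thread, so the next thread to become free is the one with the largest remaining
budget; it retrieves a uniformly random cube. The first argument bounds the number of retrievals. -/
noncomputable def episodeLoop (q : Query A) (o : List A) :
    ℕ → Multiset (Cube A) → Multiset (Cube A) → Multiset ℕ → ℝ≥0 → PMF (Multiset (Cube A) × ℝ≥0)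
  | 0, pool, left, _, r => PMF.pure (pool + left, r)
  | k + 1, pool, left, budgets, r =>
    if h : pool ≠ 0 ∧ 0 < budgets.sup then
      (PMF.ofMultiset pool h.1).bind fun c =>
        let out := joinOneCube q budgets.sup o c
        episodeLoop q o k (pool.erase c) (left + (out.left : Multiset (Cube A)))
          ((budgets.sup - out.steps) ::ₘ budgets.erase budgets.sup) (r + reward q out.done)
    else PMF.pure (pool + left, r)

/-- One episode: execute order `o` with `n` threads and a budget of `b` steps per thread, starting
from the unprocessed cubes `U`. The result is the joint law of the new set of unprocessed cubes and
the episode's reward. Each retrieval takes one cube, so `U.card` bounds their number. -/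
noncomputable def episode (q : Query A) (n b : ℕ) (o : List A) (U : Multiset (Cube A)) :
    PMF (Multiset (Cube A) × ℝ≥0) :=
  episodeLoop q o U.card U 0 (Multiset.replicate n b) 0

/-- The law of the set of unprocessed cubes after `k` episodes that all use order `o`. -/
noncomputable def remaining [Nonempty A] (q : Query A) (n b : ℕ) (o : List A) :
    ℕ → PMF (Multiset (Cube A))
  | 0 => PMF.pure (q.initCubes n)
  | k + 1 => (remaining q n b o k).bind fun U => (episode q n b o U).map Prod.fst

/-- The expected number of episodes that processing the query with order `o` takes, i.e. of episodes
that start with a nonempty set of unprocessed cubes. -/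
noncomputable def expectedEpisodes [Nonempty A] (q : Query A) (n b : ℕ) (o : List A) : ℝ≥0∞ :=
  ∑' k, (remaining q n b o k).toOuterMeasure {U | U ≠ 0}

/-- The expected reward accumulated over all these episodes. -/
noncomputable def expectedReward [Nonempty A] (q : Query A) (n b : ℕ) (o : List A) : ℝ≥0∞ :=
  ∑' k, ∑' U, remaining q n b o k U * ∑' x, episode q n b o U x * (x.2 : ℝ≥0∞)

/-- The average reward per episode of order `o`. -/
noncomputable def averageReward [Nonempty A] (q : Query A) (n b : ℕ) (o : List A) : ℝ :=
  (expectedReward q n b o / expectedEpisodes q n b o).toReal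

/-- The expected number of computational steps for processing the query with order `o`. Each episode
takes the same number `n * b` of steps: `b` for each thread. -/
noncomputable def expectedSteps [Nonempty A] (q : Query A) (n b : ℕ) (o : List A) : ℝ≥0∞ :=
  (n * b : ℝ≥0∞) * expectedEpisodes q n b o

/-! ### The search space of attribute orders -/

/-- Two attributes connect if they occur in a common relation or join predicate. -/
def Query.Connects (q : Query A) (a a' : A) : Prop :=
  (∃ R ∈ q.rels, a ∈ R.scope ∧ a' ∈ R.scope) ∨ (∃ P ∈ q.preds, a ∈ P.scope ∧ a' ∈ P.scope)

/-- `a` may be appended to the prefix `p`: it is not in `p` and, unless `p` is empty, connects to an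
attribute of `p`. -/
def Query.Action (q : Query A) (p : List A) (a : A) : Prop :=
  a ∉ p ∧ (p = [] ∨ ∃ a' ∈ p, q.Connects a a')

/-- The complete attribute orders in the search space. -/
def Query.IsOrder (q : Query A) (o : List A) : Prop :=
  (∀ a, a ∈ o) ∧ ∀ p a, p ++ [a] <+: o → q.Action p a

/-- `o` is an optimal attribute order: it minimizes the number of computational steps. -/
def IsOptimal [Nonempty A] (q : Query A) (n b : ℕ) (o : List A) : Prop :=
  q.IsOrder o ∧ ∀ o', q.IsOrder o' → expectedSteps q n b o ≤ expectedSteps q n b o'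

/-! ### UCT -/

/-- Reward statistics of the search tree: for each prefix, the number of episodes and the sum of the
rewards recorded at its node. A non-root prefix has a node iff its count is positive. -/
structure Stats (A : Type*) where
  count : List A → ℕ
  total : List A → ℝ

/-- The mean reward recorded at a node. -/
noncomputable def Stats.mean (S : Stats A) (p : List A) : ℝ := S.total p / S.count p

/-- The upper confidence bound of the child `p ++ [a]`, with exploration constant `C`. -/
noncomputable def Stats.ucb (S : Stats A) (C : ℝ) (p : List A) (a : A) : ℝ :=
  S.mean (p ++ [a]) + C * Real.sqrt (Real.log (S.count p) / S.count (p ++ [a]))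

open Classical in
/-- Update after selecting order `o` with reward `r`: the reward is recorded at all nodes on the path,
and at a new node for the first prefix of `o` that has no node (i.e. at those prefixes whose parent
is the root or already has a node). -/
noncomputable def Stats.update (S : Stats A) (o : List A) (r : ℝ) : Stats A where
  count p := if p <+: o ∧ (p.dropLast = [] ∨ 0 < S.count p.dropLast) then S.count p + 1
    else S.count p
  total p := if p <+: o ∧ (p.dropLast = [] ∨ 0 < S.count p.dropLast) then S.total p + r
    else S.total p

/-- The UCT rule at prefix `p`: if some successors have no node, go to one of those (any of them);
otherwise go to a successor with maximal upper confidence bound. -/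
def UCTStep (q : Query A) (C : ℝ) (S : Stats A) (p : List A) (a : A) : Prop :=
  q.Action p a ∧
    ((∃ a', q.Action p a' ∧ S.count (p ++ [a']) = 0) → S.count (p ++ [a]) = 0) ∧
    ((∀ a', q.Action p a' → S.count (p ++ [a']) ≠ 0) →
      ∀ a', q.Action p a' → S.ucb C p a' ≤ S.ucb C p a)

/-- The complete order `o` can be selected by UCT under the statistics `S`. -/
def UCTSelects (q : Query A) (C : ℝ) (S : Stats A) (o : List A) : Prop :=
  q.IsOrder o ∧ ∀ p a, p ++ [a] <+: o → UCTStep q C S p a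

open Classical in
/-- The reward of episode `t`, if `sel` are the selected orders and `X o k` is the reward of the
`k`-th execution (counted from zero) of order `o`. -/
noncomputable def episodeReward (X : List A → ℕ → ℝ) (sel : ℕ → List A) (t : ℕ) : ℝ :=
  X (sel t) ((Finset.range t).filter (fun s => sel s = sel t)).card

/-- The statistics before episode `t`. -/
noncomputable def stats (X : List A → ℕ → ℝ) (sel : ℕ → List A) : ℕ → Stats A
  | 0 => ⟨fun _ => 0, fun _ => 0⟩
  | t + 1 => (stats X sel t).update (sel t) (episodeReward X sel t)

/-- `sel` is a sequence of orders selected by ADOPT in the episodes `0, 1, 2, …`. -/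
def IsRun (q : Query A) (C : ℝ) (X : List A → ℕ → ℝ) (sel : ℕ → List A) : Prop :=
  ∀ t, UCTSelects q C (stats X sel t) (sel t)

/-- `o` is the order currently estimated to be best: at each prefix it continues with a successor of
maximal mean reward. -/
def IsGreedy (q : Query A) (S : Stats A) (o : List A) : Prop :=
  q.IsOrder o ∧ ∀ p a, p ++ [a] <+: o →
    ∀ a', q.Action p a' → S.mean (p ++ [a']) ≤ S.mean (p ++ [a])

end Adopt

/-!
In every run of a join the rewards of the episodes are the fractions of the query volume processed
in them, and they sum up to `1`. Hence `averageReward q n b o` is the inverse of the expected number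
of episodes, and the orders with the fewest expected steps are those with the largest average
reward.

A UCT node that is visited infinitely often visits every child infinitely often, since the
exploration bonus of a neglected child grows without bound. A child whose limiting mean reward is
smaller than that of a sibling can then be chosen only while its count is at most of the order of
the logarithm of the count of the node, so the mean reward of the node tends to the largest limit
among its children. Starting from the complete orders, where the strong law of large numbers
applies, the mean reward of a prefix therefore tends to the largest average reward of an order that
extends it, and orders that are not optimal are selected only in `o(T)` of the first `T` episodes.
-/

namespace Adopt

/-! ### Volumes -/

lemma Cube.restrict_self {A : Type*} [DecidableEq A] (c : Cube A) (a : A) :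
    c.restrict a (c.lo a) (c.hi a) = c := by
  simp [Cube.restrict]

section Volume

variable {A : Type*} [Fintype A]

/-- The sum of the volumes of a collection of cubes; for pairwise disjoint cubes, this is the
number of value vectors they cover. -/
def totalVolume (U : Multiset (Cube A)) : ℕ := (U.map Cube.volume).sum

@[simp] lemma totalVolume_zero : totalVolume (0 : Multiset (Cube A)) = 0 := rfl

@[simp] lemma totalVolume_cons (c : Cube A) (U : Multiset (Cube A)) :
    totalVolume (c ::ₘ U) = c.volume + totalVolume U := by
  simp [totalVolume]

@[simp] lemma totalVolume_singleton (c : Cube A) : totalVolume {c} = c.volume := by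
  simp [totalVolume]

lemma totalVolume_add (U W : Multiset (Cube A)) :
    totalVolume (U + W) = totalVolume U + totalVolume W := by
  simp [totalVolume]

lemma totalVolume_coe (l : List (Cube A)) :
    totalVolume (l : Multiset (Cube A)) = (l.map Cube.volume).sum := by
  simp [totalVolume]

@[simp] lemma totalVolume_coe_cons (c : Cube A) (l : List (Cube A)) :
    totalVolume ((c :: l : List (Cube A)) : Multiset (Cube A)) =
      c.volume + totalVolume (l : Multiset (Cube A)) := by
  rw [← Multiset.cons_coe, totalVolume_cons]

lemma totalVolume_filter_pos (U : Multiset (Cube A)) :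
    totalVolume (U.filter (fun c => 0 < c.volume)) = totalVolume U := by
  induction U using Multiset.induction_on with
  | empty => simp
  | cons c U ih =>
    by_cases h : 0 < c.volume
    · simp [h, ih]
    · rw [Multiset.filter_cons_of_neg (p := fun c : Cube A => 0 < c.volume) _ h, ih,
        totalVolume_cons]
      omega

lemma eq_zero_of_totalVolume_eq_zero {U : Multiset (Cube A)} (hU : ∀ c ∈ U, 0 < c.volume)
    (h : totalVolume U = 0) : U = 0 := by
  refine Multiset.eq_zero_of_forall_notMem fun c hc => (hU c hc).ne' ?_
  exact Multiset.sum_eq_zero_iff.1 h _ (Multiset.mem_map_of_mem _ hc)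

lemma Query.volume_cube_pos (q : Query A) : 0 < q.cube.volume :=
  Finset.prod_pos fun a _ => by simpa [Query.cube] using q.lo_lt_hi a

variable [DecidableEq A]

lemma Cube.volume_restrict (c : Cube A) (a : A) (l h : ℤ) :
    (c.restrict a l h).volume =
      (h - l).toNat * ∏ x ∈ Finset.univ.erase a, (c.hi x - c.lo x).toNat := by
  rw [Cube.volume, ← Finset.mul_prod_erase _ _ (Finset.mem_univ a)]
  congr 1
  · simp [Cube.restrict]
  · refine Finset.prod_congr rfl fun x hx => ?_
    simp [Cube.restrict, Finset.ne_of_mem_erase hx]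

lemma Cube.volume_restrict_add (c : Cube A) (a : A) {l m h : ℤ} (hlm : l ≤ m) (hmh : m ≤ h) :
    (c.restrict a l m).volume + (c.restrict a m h).volume = (c.restrict a l h).volume := by
  rw [volume_restrict, volume_restrict, volume_restrict, ← add_mul]
  congr 1
  omega

lemma Cube.volume_restrict_pos {c : Cube A} (hc : 0 < c.volume) (a : A) {l h : ℤ} (hlh : l < h) :
    0 < (c.restrict a l h).volume := by
  rw [← c.restrict_self a, volume_restrict] at hc
  rw [volume_restrict]
  exact Nat.mul_pos (by omega) (Nat.pos_of_mul_pos_left hc)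

lemma sum_range_toNat_sub {f : ℕ → ℤ} (hf : Monotone f) (n : ℕ) :
    ∑ i ∈ Finset.range n, (f (i + 1) - f i).toNat = (f n - f 0).toNat := by
  zify
  simp only [Int.toNat_of_nonneg, sub_nonneg, hf (Nat.zero_le n), hf (Nat.le_succ _)]
  exact Finset.sum_range_sub f n

lemma totalVolume_initCubes [Nonempty A] (q : Query A) {n : ℕ} (hn : 1 ≤ n) :
    totalVolume (q.initCubes n) = q.cube.volume := by
  have hn' : (0 : ℤ) < n := by exact_mod_cast hn
  let a := q.widest
  let cut : ℕ → ℤ := fun i => q.lo a + (i * (q.hi a - q.lo a)) / n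
  have hcut : Monotone cut := fun i j hij =>
    add_le_add_right (Int.ediv_le_ediv hn' (mul_le_mul_of_nonneg_right (by exact_mod_cast hij)
      (sub_nonneg.2 (q.lo_lt_hi a).le))) _
  have hcut_zero : cut 0 = q.cube.lo a := by simp [cut, Query.cube]
  have hcut_last : cut n = q.cube.hi a := by
    simp [cut, Query.cube, Int.mul_ediv_cancel_left _ hn'.ne']
  calc totalVolume (q.initCubes n)
      = ∑ i ∈ Finset.range n, (q.cube.restrict a (cut i) (cut (i + 1))).volume := by
        rw [Query.initCubes, totalVolume_filter_pos, totalVolume, Multiset.map_map]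
        rfl
    _ = (q.cube.restrict a (cut 0) (cut n)).volume := by
        simp only [Cube.volume_restrict, ← Finset.sum_mul, sum_range_toNat_sub hcut]
    _ = q.cube.volume := by rw [hcut_zero, hcut_last, Cube.restrict_self]

lemma volume_pos_of_mem_initCubes [Nonempty A] {q : Query A} {n : ℕ} {c : Cube A}
    (hc : c ∈ q.initCubes n) : 0 < c.volume := by
  rw [Query.initCubes] at hc
  exact (Multiset.mem_filter.1 hc).2

end Volume

/-! ### Processing one cube -/

section Join

variable {A : Type*} [DecidableEq A]

/-- `StopsIn c o vs`: the values `vs` of the first attributes of `o` are a place inside the cube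
`c` at which a join with order `o` can be stopped. The cube shrinks along the order, in step with
the recursion in `processed` and `unprocessed`. -/
inductive StopsIn : Cube A → List A → List ℤ → Prop
  | last {c : Cube A} {a : A} {v : ℤ} (o : List A) (hv : v ∈ Set.Ico (c.lo a) (c.hi a)) :
      StopsIn c (a :: o) [v]
  | cons {c : Cube A} {a : A} {v w : ℤ} {o : List A} {vs : List ℤ}
      (hv : v ∈ Set.Ico (c.lo a) (c.hi a))
      (h : StopsIn (c.restrict a v (v + 1)) o (w :: vs)) : StopsIn c (a :: o) (v :: w :: vs)

lemma StopsIn.ne_nil {c : Cube A} {o : List A} {vs : List ℤ} (h : StopsIn c o vs) : vs ≠ [] := by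
  cases h <;> simp

lemma mem_and_eq_of_scan_eq_some {b : ℕ} {f : ℤ → ℕ → ℕ × Option (List ℤ)} {l : List ℤ}
    {s s' : ℕ} {vs : List ℤ} (h : scan b f l s = (s', some vs)) :
    ∃ v ∈ l, vs = [v] ∨ ∃ s₁ s₂ w, f v s₁ = (s₂, some w) ∧ vs = v :: w := by
  induction l generalizing s with
  | nil => simp [scan] at h
  | cons v l ih =>
    rw [scan] at h
    split at h
    · next s₂ w hw =>
      simp only [Prod.mk.injEq, Option.some.injEq] at h
      exact ⟨v, by simp, Or.inr ⟨s, s₂, w, hw, h.2.symm⟩⟩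
    · split at h
      · simp only [Prod.mk.injEq, Option.some.injEq] at h
        exact ⟨v, by simp, Or.inl h.2.symm⟩
      · obtain ⟨u, hu, h⟩ := ih h
        exact ⟨u, by simp [hu], h⟩

lemma Query.mem_Ico_of_mem_values {q : Query A} {c : Cube A} {F : Finset A} {M : A → ℤ} {a : A}
    {v : ℤ} (hv : v ∈ q.values c F M a) : v ∈ Set.Ico (c.lo a) (c.hi a) := by
  simp only [Query.values, Finset.mem_sort, Finset.mem_filter, Finset.mem_Ico] at hv
  exact hv.1

lemma stopsIn_of_joinRec_eq_some {q : Query A} {b : ℕ} {c c' : Cube A} {o : List A}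
    (ho : o.Nodup) (hc : ∀ a ∈ o, c'.lo a = c.lo a ∧ c'.hi a = c.hi a) {F : Finset A}
    {M : A → ℤ} {s s' : ℕ} {vs : List ℤ} (h : joinRec q b c o F M s = (s', some vs)) :
    StopsIn c' o vs := by
  induction o generalizing c' F M s s' vs with
  | nil => simp [joinRec] at h
  | cons a o ih =>
    obtain ⟨ha, ho⟩ := List.nodup_cons.1 ho
    obtain ⟨v, hv, h⟩ := mem_and_eq_of_scan_eq_some h
    have hv' : v ∈ Set.Ico (c'.lo a) (c'.hi a) := by
      rw [(hc a (by simp)).1, (hc a (by simp)).2]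
      exact Query.mem_Ico_of_mem_values hv
    rcases h with rfl | ⟨s₁, s₂, w, hw, rfl⟩
    · exact .last o hv'
    · have hrest : StopsIn (c'.restrict a v (v + 1)) o w := by
        refine ih ho (fun x hx => ?_) hw
        have hxa : x ≠ a := fun e => ha (e ▸ hx)
        simpa [Cube.restrict, hxa] using hc x (by simp [hx])
      obtain ⟨w, ws, rfl⟩ := List.exists_cons_of_ne_nil hrest.ne_nil
      exact .cons hv' hrest

variable [Fintype A]

lemma StopsIn.totalVolume_processed_add_unprocessed {c : Cube A} {o : List A} {vs : List ℤ}
    (h : StopsIn c o vs) :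
    totalVolume (processed o vs c : Multiset (Cube A)) +
      totalVolume (unprocessed o vs c : Multiset (Cube A)) = c.volume := by
  induction h with
  | @last c a v o hv =>
    have := c.volume_restrict_add a (Int.le_add_one hv.1) (Int.add_one_le_of_lt hv.2)
    rw [c.restrict_self] at this
    simpa [processed, unprocessed] using this
  | @cons c a v w o vs hv _ ih =>
    have hbelow := c.volume_restrict_add a hv.1 (Int.le_add_one le_rfl)
    have habove := c.volume_restrict_add a (Int.le_add_one hv.1) (Int.add_one_le_of_lt hv.2)
    rw [c.restrict_self] at habove
    simp only [processed, unprocessed, totalVolume_coe_cons]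
    omega

lemma StopsIn.totalVolume_processed_pos {c : Cube A} {o : List A} {vs : List ℤ}
    (h : StopsIn c o vs) (hc : 0 < c.volume) :
    0 < totalVolume (processed o vs c : Multiset (Cube A)) := by
  induction h with
  | @last c a v o hv =>
    simpa [processed] using Cube.volume_restrict_pos hc a (Int.lt_add_one_of_le hv.1)
  | @cons c a v w o vs _ _ ih =>
    simpa [processed] using Or.inr (ih (Cube.volume_restrict_pos hc a (lt_add_one v)))

variable {q : Query A} {b : ℕ} {o : List A} {c : Cube A}

lemma totalVolume_joinOneCube (ho : o.Nodup) :
    totalVolume ((joinOneCube q b o c).done : Multiset (Cube A)) +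
      totalVolume ((joinOneCube q b o c).left : Multiset (Cube A)) = c.volume := by
  rw [joinOneCube]
  split
  · simp
  · next s vs h =>
    rw [← Multiset.filter_coe, totalVolume_filter_pos]
    exact (stopsIn_of_joinRec_eq_some ho (by simp) h).totalVolume_processed_add_unprocessed

lemma totalVolume_done_joinOneCube_pos (ho : o.Nodup) (hc : 0 < c.volume) :
    0 < totalVolume ((joinOneCube q b o c).done : Multiset (Cube A)) := by
  rw [joinOneCube]
  split
  · simpa using hc
  · next s vs h => exact (stopsIn_of_joinRec_eq_some ho (by simp) h).totalVolume_processed_pos hc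

lemma volume_pos_of_mem_left_joinOneCube {u : Cube A} (hu : u ∈ (joinOneCube q b o c).left) :
    0 < u.volume := by
  rw [joinOneCube] at hu
  split at hu
  · simp at hu
  · simpa using (List.mem_filter.1 hu).2

end Join

/-! ### Expectations -/

section Expect

variable {α β : Type*}

/-- The expectation of a nonnegative function `g` under `p`, as a sum, so that no measurable
structure is needed on `α`. -/
noncomputable def expect (p : PMF α) (g : α → ℝ≥0∞) : ℝ≥0∞ := ∑' x, p x * g x

lemma expect_pure (a : α) (g : α → ℝ≥0∞) : expect (PMF.pure a) g = g a := by
  classical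
  rw [expect, tsum_eq_single a fun b hb => by simp [hb]]
  simp

lemma expect_bind (p : PMF α) (f : α → PMF β) (g : β → ℝ≥0∞) :
    expect (p.bind f) g = expect p fun a => expect (f a) g := by
  simp only [expect, PMF.bind_apply, ← ENNReal.tsum_mul_left, ← ENNReal.tsum_mul_right]
  rw [ENNReal.tsum_comm]
  simp only [mul_assoc]

lemma expect_map (p : PMF α) (f : α → β) (g : β → ℝ≥0∞) :
    expect (p.map f) g = expect p fun a => g (f a) := by
  simp only [PMF.map, expect_bind, Function.comp_apply, expect_pure]

lemma expect_congr {p : PMF α} {g g' : α → ℝ≥0∞} (h : ∀ x ∈ p.support, g x = g' x) :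
    expect p g = expect p g' := by
  refine tsum_congr fun x => ?_
  by_cases hx : x ∈ p.support
  · rw [h x hx]
  · simp [(p.apply_eq_zero_iff x).2 hx]

lemma expect_const (p : PMF α) (r : ℝ≥0∞) : expect p (fun _ => r) = r := by
  rw [expect, ENNReal.tsum_mul_right, p.tsum_coe, one_mul]

lemma expect_add (p : PMF α) (g g' : α → ℝ≥0∞) :
    expect p (fun x => g x + g' x) = expect p g + expect p g' := by
  simp only [expect, mul_add, ENNReal.tsum_add]

lemma expect_mul_const (p : PMF α) (g : α → ℝ≥0∞) (r : ℝ≥0∞) :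
    expect p (fun x => g x * r) = expect p g * r := by
  simp only [expect, ← mul_assoc, ENNReal.tsum_mul_right]

end Expect

/-! ### Episodes -/

section Episode

variable {A : Type*} [Fintype A]

lemma reward_mul_volume (q : Query A) (P : List (Cube A)) :
    reward q P * q.cube.volume = totalVolume (P : Multiset (Cube A)) := by
  rw [reward, totalVolume_coe, div_mul_cancel₀ _ (by exact_mod_cast q.volume_cube_pos.ne')]

lemma reward_pos (q : Query A) {P : List (Cube A)}
    (hP : 0 < totalVolume (P : Multiset (Cube A))) : 0 < reward q P :=
  pos_of_mul_pos_left (b := (q.cube.volume : ℝ≥0))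
    (by rw [reward_mul_volume]; exact_mod_cast hP) zero_le

variable [DecidableEq A] {q : Query A} {n b : ℕ} {o : List A} {U : Multiset (Cube A)}
  {x : Multiset (Cube A) × ℝ≥0}

open Classical in
lemma episodeLoop_invariant {I : Multiset (Cube A) → ℝ≥0 → Prop}
    (hstep : ∀ U c b r, c ∈ U → I U r →
      I (U.erase c + (joinOneCube q b o c).left) (r + reward q (joinOneCube q b o c).done))
    {k : ℕ} {pool left : Multiset (Cube A)} {budgets : Multiset ℕ} {r : ℝ≥0}
    (hx : x ∈ (episodeLoop q o k pool left budgets r).support) (h : I (pool + left) r) :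
    I x.1 x.2 := by
  induction k generalizing pool left budgets r with
  | zero =>
    rw [episodeLoop, PMF.mem_support_pure_iff] at hx
    rwa [hx]
  | succ k ih =>
    rw [episodeLoop] at hx
    split at hx
    · obtain ⟨c, hc, hx⟩ := (PMF.mem_support_bind_iff _ _ _).1 hx
      rw [PMF.mem_support_ofMultiset_iff, Multiset.mem_toFinset] at hc
      refine ih hx ?_
      rw [← add_assoc, ← Multiset.erase_add_left_pos _ hc]
      exact hstep _ _ _ _ (Multiset.mem_add.2 (.inl hc)) h
    · rw [PMF.mem_support_pure_iff] at hx
      rwa [hx]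

lemma volume_pos_of_mem_episode (hx : x ∈ (episode q n b o U).support)
    (hU : ∀ c ∈ U, 0 < c.volume) : ∀ c ∈ x.1, 0 < c.volume := by
  classical
  refine episodeLoop_invariant (I := fun U _ => ∀ c ∈ U, 0 < c.volume)
    (fun U c b _ _ hU u hu => ?_) hx (by simpa using hU)
  rcases Multiset.mem_add.1 hu with hu | hu
  · exact hU u (Multiset.mem_of_mem_erase hu)
  · exact volume_pos_of_mem_left_joinOneCube hu

lemma totalVolume_add_reward_of_mem_episode (ho : o.Nodup)
    (hx : x ∈ (episode q n b o U).support) :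
    (totalVolume x.1 : ℝ≥0) + x.2 * q.cube.volume = totalVolume U := by
  classical
  refine episodeLoop_invariant
    (I := fun W r => (totalVolume W : ℝ≥0) + r * q.cube.volume = totalVolume U)
    (fun W c b r hc hW => ?_) hx (by simp)
  have hsplit : totalVolume (W.erase c + ((joinOneCube q b o c).left : Multiset (Cube A))) +
      totalVolume ((joinOneCube q b o c).done : Multiset (Cube A)) = totalVolume W := by
    have hjoin := totalVolume_joinOneCube (q := q) (b := b) (c := c) ho
    have herase := totalVolume_cons c (W.erase c)
    rw [Multiset.cons_erase hc] at herase
    rw [totalVolume_add]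
    omega
  rw [← hW, ← hsplit, add_mul, reward_mul_volume]
  push_cast
  ring

lemma reward_pos_of_mem_episode (hn : 1 ≤ n) (hb : 1 ≤ b) (ho : o.Nodup)
    (hx : x ∈ (episode q n b o U).support) (hU : ∀ c ∈ U, 0 < c.volume) (hU0 : U ≠ 0) :
    0 < x.2 := by
  classical
  obtain ⟨k, hk⟩ := Nat.exists_eq_succ_of_ne_zero (mt Multiset.card_eq_zero.1 hU0)
  have hbudget : 0 < (Multiset.replicate n b).sup :=
    hb.trans (Multiset.le_sup (Multiset.mem_replicate.2 ⟨by omega, rfl⟩))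
  rw [episode, hk, episodeLoop, dif_pos ⟨hU0, hbudget⟩] at hx
  obtain ⟨c, hc, hx⟩ := (PMF.mem_support_bind_iff _ _ _).1 hx
  rw [PMF.mem_support_ofMultiset_iff, Multiset.mem_toFinset] at hc
  have hfirst := reward_pos q (totalVolume_done_joinOneCube_pos (q := q)
    (b := (Multiset.replicate n b).sup) ho (hU c hc))
  refine hfirst.trans_le ?_
  exact episodeLoop_invariant (I := fun _ r => _ ≤ r)
    (fun _ _ _ _ _ h => h.trans le_self_add) hx (zero_add _).ge

variable [Nonempty A] {k : ℕ}

lemma mem_support_remaining_succ {W : Multiset (Cube A)} :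
    W ∈ (remaining q n b o (k + 1)).support ↔ ∃ U ∈ (remaining q n b o k).support,
      ∃ x ∈ (episode q n b o U).support, x.1 = W := by
  simp only [remaining, PMF.mem_support_bind_iff, PMF.mem_support_map_iff]

lemma volume_pos_of_mem_remaining (hU : U ∈ (remaining q n b o k).support) :
    ∀ c ∈ U, 0 < c.volume := by
  induction k generalizing U with
  | zero =>
    rw [remaining, PMF.mem_support_pure_iff] at hU
    exact hU ▸ fun c hc => volume_pos_of_mem_initCubes hc
  | succ k ih =>
    obtain ⟨W, hW, x, hx, rfl⟩ := mem_support_remaining_succ.1 hU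
    exact volume_pos_of_mem_episode hx (ih hW)

lemma totalVolume_add_le_of_mem_remaining (hn : 1 ≤ n) (hb : 1 ≤ b) (ho : o.Nodup)
    (hU : U ∈ (remaining q n b o k).support) (hU0 : U ≠ 0) :
    totalVolume U + k ≤ q.cube.volume := by
  induction k generalizing U with
  | zero =>
    rw [remaining, PMF.mem_support_pure_iff] at hU
    exact hU ▸ (totalVolume_initCubes q hn).le
  | succ k ih =>
    obtain ⟨W, hW, x, hx, rfl⟩ := mem_support_remaining_succ.1 hU
    have hWpos := volume_pos_of_mem_remaining hW
    have hsum := totalVolume_add_reward_of_mem_episode ho hx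
    have hW0 : W ≠ 0 := by
      rintro rfl
      refine hU0 (eq_zero_of_totalVolume_eq_zero (volume_pos_of_mem_episode hx hWpos) ?_)
      exact_mod_cast (add_eq_zero.1 (hsum.trans (by simp))).1
    have hlt : (totalVolume x.1 : ℝ≥0) < totalVolume W := by
      rw [← hsum]
      exact lt_add_of_pos_right _ (mul_pos (reward_pos_of_mem_episode hn hb ho hx hWpos hW0)
        (by exact_mod_cast q.volume_cube_pos))
    have hlt : totalVolume x.1 < totalVolume W := by exact_mod_cast hlt
    have := ih hW hW0
    omega

lemma eq_zero_of_mem_remaining (hn : 1 ≤ n) (hb : 1 ≤ b) (ho : o.Nodup)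
    (hk : q.cube.volume < k) (hU : U ∈ (remaining q n b o k).support) : U = 0 := by
  by_contra hU0
  have := totalVolume_add_le_of_mem_remaining hn hb ho hU hU0
  omega

/-- The expected unprocessed volume after `k` episodes with order `o`. -/
noncomputable def expectedVolume (q : Query A) (n b : ℕ) (o : List A) (k : ℕ) : ℝ≥0∞ :=
  expect (remaining q n b o k) fun U => totalVolume U

/-- The expected reward of episode `k` if all episodes use order `o`; the terms of the series
`expectedReward`. -/
noncomputable def episodeExpectedReward (q : Query A) (n b : ℕ) (o : List A) (k : ℕ) : ℝ≥0∞ :=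
  expect (remaining q n b o k) fun U => expect (episode q n b o U) fun x => (x.2 : ℝ≥0∞)

lemma expectedReward_eq_tsum (q : Query A) (n b : ℕ) (o : List A) :
    expectedReward q n b o = ∑' k, episodeExpectedReward q n b o k := rfl

lemma expectedVolume_zero (hn : 1 ≤ n) : expectedVolume q n b o 0 = q.cube.volume := by
  rw [expectedVolume, remaining, expect_pure, totalVolume_initCubes q hn]

lemma expectedVolume_succ_add (ho : o.Nodup) (k : ℕ) :
    expectedVolume q n b o (k + 1) + episodeExpectedReward q n b o k * q.cube.volume =
      expectedVolume q n b o k := by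
  rw [expectedVolume, remaining, expect_bind, episodeExpectedReward, ← expect_mul_const,
    ← expect_add, expectedVolume]
  refine expect_congr fun U _ => ?_
  rw [expect_map, ← expect_mul_const, ← expect_add,
    ← expect_const (episode q n b o U) (totalVolume U)]
  refine expect_congr fun x hx => ?_
  exact_mod_cast congrArg (fun y : ℝ≥0 => (y : ℝ≥0∞))
    (totalVolume_add_reward_of_mem_episode ho hx)

lemma expectedVolume_eq_zero (hn : 1 ≤ n) (hb : 1 ≤ b) (ho : o.Nodup) (hk : q.cube.volume < k) :
    expectedVolume q n b o k = 0 := by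
  rw [expectedVolume, ← expect_const (remaining q n b o k) 0]
  refine expect_congr fun U hU => ?_
  simp [eq_zero_of_mem_remaining hn hb ho hk hU]

lemma expectedVolume_add_sum (hn : 1 ≤ n) (ho : o.Nodup) (K : ℕ) :
    expectedVolume q n b o K +
      (∑ k ∈ Finset.range K, episodeExpectedReward q n b o k) * q.cube.volume =
        q.cube.volume := by
  induction K with
  | zero => simp [expectedVolume_zero hn]
  | succ K ih =>
    rw [Finset.sum_range_succ, add_mul, add_comm (_ * _) (_ * _), ← add_assoc,
      expectedVolume_succ_add ho, ih]

lemma expectedReward_eq_one (hn : 1 ≤ n) (hb : 1 ≤ b) (ho : o.Nodup) :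
    expectedReward q n b o = 1 := by
  have hV : (q.cube.volume : ℝ≥0∞) ≠ 0 := by exact_mod_cast q.volume_cube_pos.ne'
  have hzero : ∀ k ∉ Finset.range (q.cube.volume + 1), episodeExpectedReward q n b o k = 0 := by
    intro k hk
    rw [Finset.mem_range, not_lt] at hk
    have h := expectedVolume_succ_add (q := q) (n := n) (b := b) ho k
    rw [expectedVolume_eq_zero hn hb ho hk, add_eq_zero, mul_eq_zero] at h
    exact h.2.resolve_right hV
  have hsum := expectedVolume_add_sum (q := q) (b := b) hn ho (q.cube.volume + 1)
  rw [expectedVolume_eq_zero hn hb ho (Nat.lt_succ_self _), zero_add] at hsum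
  rw [expectedReward_eq_tsum, tsum_eq_sum hzero]
  exact (ENNReal.mul_left_inj hV (ENNReal.natCast_ne_top _)).1 (hsum.trans (one_mul _).symm)

lemma expectedEpisodes_ne_top (hn : 1 ≤ n) (hb : 1 ≤ b) (ho : o.Nodup) :
    expectedEpisodes q n b o ≠ ⊤ := by
  have hzero : ∀ k ∉ Finset.range (q.cube.volume + 1),
      (remaining q n b o k).toOuterMeasure {U | U ≠ 0} = 0 := by
    intro k hk
    rw [Finset.mem_range, not_lt] at hk
    rw [PMF.toOuterMeasure_apply_eq_zero_iff, Set.disjoint_left]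
    exact fun U hU h => h (eq_zero_of_mem_remaining hn hb ho hk hU)
  rw [expectedEpisodes, tsum_eq_sum hzero]
  refine ENNReal.sum_ne_top.2 fun k _ => ne_top_of_le_ne_top ENNReal.one_ne_top ?_
  rw [PMF.toOuterMeasure_apply, ← (remaining q n b o k).tsum_coe]
  exact ENNReal.tsum_le_tsum fun U => Set.indicator_le_self _ _ U

lemma expectedEpisodes_ne_zero (hn : 1 ≤ n) : expectedEpisodes q n b o ≠ 0 := by
  intro h
  have h := ENNReal.tsum_eq_zero.1 h 0
  rw [PMF.toOuterMeasure_apply_eq_zero_iff, remaining, PMF.support_pure,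
    Set.disjoint_singleton_left] at h
  refine h fun h0 => q.volume_cube_pos.ne' ?_
  rw [← totalVolume_initCubes q hn, h0, totalVolume_zero]

lemma averageReward_eq_inv (hn : 1 ≤ n) (hb : 1 ≤ b) (ho : o.Nodup) :
    averageReward q n b o = (expectedEpisodes q n b o).toReal⁻¹ := by
  rw [averageReward, expectedReward_eq_one hn hb ho, one_div, ENNReal.toReal_inv]

lemma expectedSteps_le_iff (hn : 1 ≤ n) (hb : 1 ≤ b) (ho : o.Nodup) {o' : List A}
    (ho' : o'.Nodup) :
    expectedSteps q n b o ≤ expectedSteps q n b o' ↔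
      averageReward q n b o' ≤ averageReward q n b o := by
  have hnb : (n * b : ℝ≥0∞) ≠ 0 := by exact_mod_cast (Nat.mul_pos hn hb).ne'
  have hnb' : (n * b : ℝ≥0∞) ≠ ⊤ := by exact_mod_cast ENNReal.natCast_ne_top (n * b)
  have htop {o : List A} (ho : o.Nodup) := expectedEpisodes_ne_top (q := q) hn hb ho
  have hpos {o : List A} (ho : o.Nodup) :=
    ENNReal.toReal_pos (expectedEpisodes_ne_zero (q := q) (b := b) hn) (htop ho)
  rw [expectedSteps, expectedSteps, ENNReal.mul_le_mul_iff_right hnb hnb',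
    averageReward_eq_inv hn hb ho, averageReward_eq_inv hn hb ho',
    inv_le_inv₀ (hpos ho') (hpos ho), ENNReal.toReal_le_toReal (htop ho) (htop ho')]

end Episode

/-! ### Growth of sequences -/

open Asymptotics

section Growth

lemma tendsto_atTop_or_exists_eventually_eq {f : ℕ → ℕ} (hf : Monotone f) :
    Tendsto f atTop atTop ∨ ∃ B, ∀ᶠ t in atTop, f t = B := by
  refine (tendsto_atTop_of_monotone hf).imp_right fun ⟨B, hB⟩ => ⟨B, ?_⟩
  rwa [nhds_discrete, tendsto_pure] at hB

lemma exists_eventually_eq_of_eventually_succ_eq {α : Type*} {f : ℕ → α}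
    (h : ∀ᶠ t in atTop, f (t + 1) = f t) : ∃ c, ∀ᶠ t in atTop, f t = c := by
  obtain ⟨t₀, h⟩ := eventually_atTop.1 h
  refine ⟨f t₀, eventually_atTop.2 ⟨t₀, fun t ht => ?_⟩⟩
  induction t, ht using Nat.le_induction with
  | base => rfl
  | succ t ht ih => rw [h t ht, ih]

lemma exists_eventually_eq_add_const {f g : ℕ → ℝ}
    (h : ∀ᶠ t in atTop, f (t + 1) - f t = g (t + 1) - g t) :
    ∃ c, ∀ᶠ t in atTop, f t = g t + c := by
  obtain ⟨c, hc⟩ := exists_eventually_eq_of_eventually_succ_eq (f := fun t => f t - g t)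
    (h.mono fun t ht => by linarith)
  exact ⟨c, hc.mono fun t ht => by linarith⟩

lemma frequently_lt_succ {f : ℕ → ℕ} (hf : Tendsto f atTop atTop) :
    ∃ᶠ t in atTop, f t < f (t + 1) := by
  intro h
  obtain ⟨t₀, h⟩ := eventually_atTop.1 h
  have hle : ∀ t ≥ t₀, f t ≤ f t₀ := fun t ht => by
    induction t, ht using Nat.le_induction with
    | base => exact le_rfl
    | succ t ht ih => exact (not_lt.1 (h t ht)).trans ih
  obtain ⟨t, ht, ht'⟩ := ((eventually_ge_atTop t₀).and (hf.eventually_gt_atTop (f t₀))).exists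
  exact (hle t ht).not_gt ht'

lemma exists_eventually_le_add {f g : ℕ → ℝ} (hf : ∀ t, f (t + 1) ≤ f t + 1)
    (hg : ∀ᶠ t in atTop, g t ≤ g (t + 1)) (h : ∀ᶠ t in atTop, f t < f (t + 1) → f t ≤ g t) :
    ∃ c, ∀ᶠ t in atTop, f t ≤ c + g t := by
  obtain ⟨t₀, ht₀⟩ := eventually_atTop.1 (hg.and h)
  refine ⟨max (f t₀ - g t₀) 1, eventually_atTop.2 ⟨t₀, fun t ht => ?_⟩⟩
  induction t, ht using Nat.le_induction with
  | base => linarith [le_max_left (f t₀ - g t₀) 1]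
  | succ t ht ih =>
    obtain ⟨hgt, hft⟩ := ht₀ t ht
    rcases le_or_gt (f (t + 1)) (f t) with hle | hlt
    · linarith
    · linarith [hft hlt, hf t, le_max_right (f t₀ - g t₀) 1]

lemma tendsto_div_iff_isLittleO {α : Type*} {l : Filter α} {f g : α → ℝ} {v : ℝ}
    (hg : ∀ᶠ t in l, g t ≠ 0) :
    Tendsto (fun t => f t / g t) l (𝓝 v) ↔ (fun t => f t - v * g t) =o[l] g := by
  rw [isLittleO_iff_tendsto' (hg.mono fun t ht h => (ht h).elim), ← tendsto_sub_nhds_zero_iff]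
  refine tendsto_congr' (hg.mono fun t ht => ?_)
  field_simp

lemma eventually_natCast_ne_zero {α : Type*} {l : Filter α} {f : α → ℕ}
    (hf : Tendsto f l atTop) : ∀ᶠ t in l, (f t : ℝ) ≠ 0 :=
  (hf.eventually_ne_atTop 0).mono fun _ ht => Nat.cast_ne_zero.2 ht

lemma isLittleO_const_natCast {α : Type*} {l : Filter α} {f : α → ℕ} (hf : Tendsto f l atTop)
    (c : ℝ) : (fun _ => c) =o[l] fun t => (f t : ℝ) :=
  isLittleO_const_left.2 <| .inr <|
    tendsto_norm_atTop_atTop.comp (tendsto_natCast_atTop_atTop.comp hf)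

lemma sqrt_div_le_half_sqrt_div {x a b : ℝ} (hx : 0 ≤ x) (ha : 0 < a) (hab : 4 * a ≤ b) :
    √(x / b) ≤ √(x / a) / 2 := by
  rw [Real.sqrt_le_left (by positivity), div_pow, Real.sq_sqrt (by positivity), div_div]
  exact div_le_div_of_nonneg_left hx (by positivity) (by linarith)

end Growth

/-! ### The UCB rule at one node -/

/-- A node with children `s` at which the children are chosen by the UCB rule with exploration
constant `C`. At time `t` the node has count `N t` and total reward `Y t`, and the child `i` has
count `n i t` and total reward `x i t`; `V i` is the limit of the mean rewards of `i`, provided that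
`i` is chosen infinitely often. Counts and totals of the node and of its children may differ by
constants, because the first rewards of a node can be recorded before its children exist. -/
structure UCBProcess {ι : Type*} (s : Finset ι) (C : ℝ) (N : ℕ → ℕ) (Y : ℕ → ℝ) (n : ι → ℕ → ℕ)
    (x : ι → ℕ → ℝ) (V : ι → ℝ) : Prop where
  mono : ∀ i ∈ s, Monotone (n i)
  step : ∀ i ∈ s, ∀ t, n i (t + 1) ≤ n i t + 1
  frozen : ∀ i ∈ s, ∀ t, n i (t + 1) = n i t → x i (t + 1) = x i t
  mono_parent : Monotone N
  tendsto_parent : Tendsto N atTop atTop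
  count_sum : ∃ c : ℝ, ∀ᶠ t in atTop, (N t : ℝ) = ∑ i ∈ s, (n i t : ℝ) + c
  total_sum : ∃ d : ℝ, ∀ᶠ t in atTop, Y t = ∑ i ∈ s, x i t + d
  rule : ∀ i ∈ s, ∀ t, n i t < n i (t + 1) → n i t ≠ 0 → ∀ j ∈ s, n j t ≠ 0 ∧
    x j t / n j t + C * √(Real.log (N t) / n j t) ≤ x i t / n i t + C * √(Real.log (N t) / n i t)
  tendsto_mean : ∀ i ∈ s, Tendsto (n i) atTop atTop →
    Tendsto (fun t => x i t / n i t) atTop (𝓝 (V i))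

namespace UCBProcess

variable {ι : Type*} {s : Finset ι} {C : ℝ} {N : ℕ → ℕ} {Y : ℕ → ℝ} {n : ι → ℕ → ℕ}
  {x : ι → ℕ → ℝ} {V : ι → ℝ} {i j : ι}

lemma tendsto_log (h : UCBProcess s C N Y n x V) :
    Tendsto (fun t => Real.log (N t)) atTop atTop :=
  Real.tendsto_log_atTop.comp (tendsto_natCast_atTop_atTop.comp h.tendsto_parent)

lemma exists_tendsto_count (h : UCBProcess s C N Y n x V) :
    ∃ i ∈ s, Tendsto (n i) atTop atTop := by
  by_contra! hcon
  have hB : ∀ i, ∃ B, i ∈ s → ∀ᶠ t in atTop, n i t = B := fun i => by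
    by_cases hi : i ∈ s
    · exact ((tendsto_atTop_or_exists_eventually_eq (h.mono i hi)).resolve_left (hcon i hi)).imp
        fun _ hB _ => hB
    · exact ⟨0, fun hi' => (hi hi').elim⟩
  choose B hB using hB
  obtain ⟨c, hc⟩ := h.count_sum
  have hN : ∀ᶠ t in atTop, (N t : ℝ) = ∑ i ∈ s, (B i : ℝ) + c := by
    filter_upwards [hc, (eventually_all_finset s).2 fun i hi => hB i hi] with t ht hn
    rw [ht, Finset.sum_congr rfl fun i hi => by rw [hn i hi]]
  obtain ⟨t, ht, ht'⟩ := (hN.and ((tendsto_natCast_atTop_atTop.comp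
    h.tendsto_parent).eventually_gt_atTop (∑ i ∈ s, (B i : ℝ) + c))).exists
  exact ht'.ne' ht

lemma exists_eventually_abs_mean_le (h : UCBProcess s C N Y n x V) (hi : i ∈ s) :
    ∃ D, ∀ᶠ t in atTop, |x i t / n i t| ≤ D := by
  rcases tendsto_atTop_or_exists_eventually_eq (h.mono i hi) with hn | ⟨B, hB⟩
  · exact ⟨|V i| + 1, ((h.tendsto_mean i hi hn).abs.eventually_lt_const (lt_add_one _)).mono
      fun _ ht => ht.le⟩
  · obtain ⟨c, hc⟩ := exists_eventually_eq_of_eventually_succ_eq (f := x i) <| by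
      filter_upwards [hB, (tendsto_add_atTop_nat 1).eventually hB] with t ht ht'
      exact h.frozen i hi t (ht'.trans ht.symm)
    refine ⟨|c / B|, ?_⟩
    filter_upwards [hB, hc] with t ht ht'
    rw [ht, ht']

lemma eventually_count_ne_zero (h : UCBProcess s C N Y n x V) (hj : j ∈ s) :
    ∀ᶠ t in atTop, n j t ≠ 0 := by
  obtain ⟨i, hi, hni⟩ := h.exists_tendsto_count
  obtain ⟨t₀, hinc, hne⟩ :=
    ((frequently_lt_succ hni).and_eventually (hni.eventually_ne_atTop 0)).exists
  have hj0 : 0 < n j t₀ := Nat.pos_of_ne_zero (h.rule i hi t₀ hinc hne j hj).1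
  filter_upwards [eventually_ge_atTop t₀] with t ht
  exact (hj0.trans_le (h.mono j hj ht)).ne'

/-- If the count of `j` stayed at `B`, its exploration bonus would tend to infinity, while the bonus
of a child chosen infinitely often is at most half as large as soon as its count exceeds `4 * B`. -/
lemma tendsto_count (h : UCBProcess s C N Y n x V) (hC : 0 < C) (hj : j ∈ s) :
    Tendsto (n j) atTop atTop := by
  refine (tendsto_atTop_or_exists_eventually_eq (h.mono j hj)).resolve_right ?_
  rintro ⟨B, hB⟩
  have hB0 : 0 < B := by
    obtain ⟨t, ht, ht'⟩ := (hB.and (h.eventually_count_ne_zero hj)).exists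
    exact ht ▸ Nat.pos_of_ne_zero ht'
  have hB' : (0 : ℝ) < B := by exact_mod_cast hB0
  obtain ⟨i, hi, hni⟩ := h.exists_tendsto_count
  obtain ⟨Di, hDi⟩ := h.exists_eventually_abs_mean_le hi
  obtain ⟨Dj, hDj⟩ := h.exists_eventually_abs_mean_le hj
  have hbonus : Tendsto (fun t => C / 2 * √(Real.log (N t) / B)) atTop atTop :=
    (Real.tendsto_sqrt_atTop.comp (h.tendsto_log.atTop_div_const hB')).const_mul_atTop
      (half_pos hC)
  obtain ⟨t, hinc, hj, hi4, hDi, hDj, hbonus⟩ := ((frequently_lt_succ hni).and_eventually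
    (hB.and ((hni.eventually_ge_atTop (4 * B)).and (hDi.and (hDj.and
      (hbonus.eventually_gt_atTop (Di + Dj))))))).exists
  have hucb := (h.rule i hi t hinc (by omega) j ‹_›).2
  have hhalf := sqrt_div_le_half_sqrt_div (Real.log_natCast_nonneg (N t)) hB'
    (b := n i t) (by exact_mod_cast hi4)
  have := mul_le_mul_of_nonneg_left hhalf hC.le
  rw [hj] at hucb hDj
  linarith [le_of_abs_le hDi, neg_le_of_abs_le hDj]

lemma tendsto_mean_of_mem (h : UCBProcess s C N Y n x V) (hC : 0 < C) (hi : i ∈ s) :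
    Tendsto (fun t => x i t / n i t) atTop (𝓝 (V i)) :=
  h.tendsto_mean i hi (h.tendsto_count hC hi)

/-- Choosing `i` although `j` has the larger mean requires an exploration bonus of `i` of at least
about `V j - V i`. -/
lemma exists_eventually_count_le_mul_log (h : UCBProcess s C N Y n x V) (hC : 0 < C) (hi : i ∈ s)
    (hj : j ∈ s) (hV : V i < V j) :
    ∃ K > 0, ∀ᶠ t in atTop, n i t < n i (t + 1) → (n i t : ℝ) ≤ K * Real.log (N t) := by
  set δ := (V j - V i) / 3 with hδ
  have hδpos : 0 < δ := by positivity
  refine ⟨(C / δ) ^ 2, by positivity, ?_⟩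
  filter_upwards [(h.tendsto_count hC hi).eventually_gt_atTop 0,
    (h.tendsto_mean_of_mem hC hi).eventually_lt_const (show V i < V i + δ by linarith),
    (h.tendsto_mean_of_mem hC hj).eventually_const_lt (show V j - δ < V j by linarith)]
    with t hpos hmean_i hmean_j hinc
  have hn : (0 : ℝ) < n i t := by exact_mod_cast hpos
  have hbonus_j : 0 ≤ C * √(Real.log (N t) / n j t) := by positivity
  have hbonus_i : δ ≤ C * √(Real.log (N t) / n i t) := by
    linarith [(h.rule i hi t hinc hpos.ne' j hj).2]
  rw [← div_le_iff₀' hC, Real.le_sqrt' (by positivity), le_div_iff₀ hn] at hbonus_i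
  calc (n i t : ℝ) = (C / δ) ^ 2 * ((δ / C) ^ 2 * n i t) := by field_simp
    _ ≤ (C / δ) ^ 2 * Real.log (N t) := by gcongr

lemma isLittleO_count (h : UCBProcess s C N Y n x V) (hC : 0 < C) (hi : i ∈ s) (hj : j ∈ s)
    (hV : V i < V j) : (fun t => (n i t : ℝ)) =o[atTop] fun t => (N t : ℝ) := by
  obtain ⟨K, hK, hle⟩ := h.exists_eventually_count_le_mul_log hC hi hj hV
  have hlog_mono : ∀ᶠ t in atTop, K * Real.log (N t) ≤ K * Real.log (N (t + 1)) := by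
    filter_upwards [h.tendsto_parent.eventually_gt_atTop 0] with t ht
    have := h.mono_parent (Nat.le_succ t)
    gcongr
  obtain ⟨c, hc⟩ := exists_eventually_le_add (f := fun t => (n i t : ℝ))
    (fun t => by exact_mod_cast h.step i hi t) hlog_mono (by simpa only [Nat.cast_lt] using hle)
  have hbound : (fun t => (n i t : ℝ)) =O[atTop] fun t => c + K * Real.log (N t) := by
    refine .of_norm_eventuallyLE ?_
    filter_upwards [hc] with t ht
    simpa using ht
  have hlog : (fun t => Real.log (N t)) =o[atTop] fun t => (N t : ℝ) :=
    Real.isLittleO_log_id_atTop.comp_tendsto (tendsto_natCast_atTop_atTop.comp h.tendsto_parent)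
  exact hbound.trans_isLittleO
    ((isLittleO_const_natCast h.tendsto_parent c).add (hlog.const_mul_left K))

lemma isBigO_count (h : UCBProcess s C N Y n x V) (hi : i ∈ s) :
    (fun t => (n i t : ℝ)) =O[atTop] fun t => (N t : ℝ) := by
  obtain ⟨c, hc⟩ := h.count_sum
  have hbound : (fun t => (n i t : ℝ)) =O[atTop] fun t => (N t : ℝ) - c := by
    refine .of_norm_eventuallyLE ?_
    filter_upwards [hc] with t ht
    rw [ht, add_sub_cancel_right, Real.norm_natCast]
    exact Finset.single_le_sum (f := fun i => (n i t : ℝ)) (fun _ _ => Nat.cast_nonneg _) hi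
  exact hbound.trans ((isBigO_refl _ _).sub (isLittleO_const_natCast h.tendsto_parent c).isBigO)

lemma isLittleO_total_sub (h : UCBProcess s C N Y n x V) (hC : 0 < C) (hle : ∀ i ∈ s, V i ≤ V j)
    (hj : j ∈ s) (hi : i ∈ s) :
    (fun t => x i t - V j * n i t) =o[atTop] fun t => (N t : ℝ) := by
  have hown : (fun t => x i t - V i * n i t) =o[atTop] fun t => (N t : ℝ) :=
    ((tendsto_div_iff_isLittleO (eventually_natCast_ne_zero (h.tendsto_count hC hi))).1
      (h.tendsto_mean_of_mem hC hi)).trans_isBigO (h.isBigO_count hi)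
  have hgap : (fun t => (V i - V j) * n i t) =o[atTop] fun t => (N t : ℝ) := by
    rcases (hle i hi).lt_or_eq with hlt | heq
    · exact (h.isLittleO_count hC hi hj hlt).const_mul_left _
    · simp [heq]
  exact (hown.add hgap).congr_left fun t => by ring

lemma tendsto_mean_parent (h : UCBProcess s C N Y n x V) (hC : 0 < C) (hj : j ∈ s)
    (hle : ∀ i ∈ s, V i ≤ V j) : Tendsto (fun t => Y t / N t) atTop (𝓝 (V j)) := by
  obtain ⟨c, hc⟩ := h.count_sum
  obtain ⟨d, hd⟩ := h.total_sum
  rw [tendsto_div_iff_isLittleO (eventually_natCast_ne_zero h.tendsto_parent)]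
  have hsum := (IsLittleO.sum fun i hi => h.isLittleO_total_sub hC hle hj hi).add
    (isLittleO_const_natCast h.tendsto_parent (d - V j * c))
  refine hsum.congr' ?_ .rfl
  filter_upwards [hc, hd] with t hN hY
  rw [hN, hY, Finset.sum_apply, Finset.sum_sub_distrib, ← Finset.mul_sum]
  ring

end UCBProcess

/-! ### Prefixes of attribute orders -/

section Orders

variable {A : Type*}

lemma exists_append_prefix {p o : List A} {x : A} (hp : p <+: o) (hx : x ∈ o) (hxp : x ∉ p) :
    ∃ a, p ++ [a] <+: o := by
  obtain ⟨_ | ⟨a, l⟩, rfl⟩ := hp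
  · exact (hxp (by simpa using hx)).elim
  · exact ⟨a, l, by simp⟩

lemma append_prefix_unique {p o : List A} {a a' : A} (h : p ++ [a] <+: o)
    (h' : p ++ [a'] <+: o) : a = a' := by
  simpa using (List.prefix_of_prefix_length_le h h' (by simp)).eq_of_length (by simp)

/-- The prefixes of orders in the search space, characterized without reference to complete orders:
every attribute of `p` can be appended to the attributes before it. -/
def Query.IsValid (q : Query A) (p : List A) : Prop :=
  ∀ p' a, p' ++ [a] <+: p → q.Action p' a

variable {q : Query A} {p p' o o' : List A} {a : A}

lemma Query.isValid_nil (q : Query A) : q.IsValid [] := by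
  simp [Query.IsValid]

lemma Query.IsOrder.isValid (h : q.IsOrder o) : q.IsValid o := h.2

lemma Query.IsValid.of_prefix (h : q.IsValid p) (hp : p' <+: p) : q.IsValid p' :=
  fun p'' a h' => h p'' a (h'.trans hp)

lemma Query.IsValid.append (h : q.IsValid p) (ha : q.Action p a) : q.IsValid (p ++ [a]) := by
  intro p' a' h'
  rcases List.prefix_concat_iff.1 h' with h' | h'
  · obtain ⟨rfl, ⟨⟩⟩ := List.append_inj' h' rfl
    exact ha
  · exact h p' a' h'

lemma Query.IsValid.nodup (h : q.IsValid p) : p.Nodup := by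
  induction p using List.reverseRecOn with
  | nil => exact List.nodup_nil
  | append_singleton p a ih =>
    rw [List.nodup_append_comm]
    exact List.nodup_cons.2 ⟨(h p a List.prefix_rfl).1, ih (h.of_prefix (List.prefix_append _ _))⟩

lemma Query.IsOrder.prefix_iff (h : q.IsOrder o) (h' : q.IsOrder o') : o <+: o' ↔ o' = o := by
  refine ⟨?_, fun e => e ▸ List.prefix_rfl⟩
  rintro ⟨l, rfl⟩
  have hl : l = [] := List.eq_nil_iff_forall_not_mem.2 fun a ha =>
    (List.disjoint_of_nodup_append h'.isValid.nodup) (h.1 a) ha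
  rw [hl, List.append_nil]

lemma Query.exists_action (hq : ∀ a a', Relation.ReflTransGen q.Connects a a')
    (hp : ∃ x, x ∉ p) : ∃ a, q.Action p a := by
  obtain ⟨x, hx⟩ := hp
  rcases p.eq_nil_or_concat with rfl | ⟨p', y, hy⟩
  · exact ⟨x, hx, Or.inl rfl⟩
  by_contra! hno
  refine hx ?_
  induction hq y x with
  | refl => simp [hy]
  | @tail u w _ huw ih =>
    have hu : u ∈ p := by_contra fun hu => hu (ih hu)
    have hwu : q.Connects w u := huw.imp (.imp fun _ h => ⟨h.1, h.2.2, h.2.1⟩)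
      (.imp fun _ h => ⟨h.1, h.2.2, h.2.1⟩)
    exact by_contra fun hw => hno w ⟨hw, Or.inr ⟨u, hu, hwu⟩⟩

section Finite

variable [Finite A]

lemma Query.finite_isValid (q : Query A) : {p | q.IsValid p}.Finite := by
  cases nonempty_fintype A
  exact (List.finite_length_le A (Fintype.card A)).subset fun _ hp => hp.nodup.length_le_card

/-- The attributes that may be appended to `p`, as the finite set of children of the tree node
`p`. -/
noncomputable def Query.actions (q : Query A) (p : List A) : Finset A :=
  (Set.toFinite {a | q.Action p a}).toFinset

lemma Query.mem_actions : a ∈ q.actions p ↔ q.Action p a :=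
  Set.Finite.mem_toFinset _

lemma Query.IsValid.induction_up {P : List A → Prop} (full : ∀ o, q.IsOrder o → P o)
    (step : ∀ p, q.IsValid p → (∃ x, x ∉ p) → (∀ a, q.Action p a → P (p ++ [a])) → P p)
    (hp : q.IsValid p) : P p := by
  induction hs : {x | x ∉ p} using WellFoundedLT.induction generalizing p with
  | _ s ih =>
    subst hs
    by_cases hx : ∃ x, x ∉ p
    · refine step p hp hx fun a ha => ih _ ?_ (hp.append ha) rfl
      exact (Set.ssubset_iff_of_subset fun x hx => by simp_all).2 ⟨a, ha.1, by simp⟩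
    · exact full p ⟨by simpa using hx, hp⟩

lemma Query.IsValid.exists_isOrder (hq : ∀ a a', Relation.ReflTransGen q.Connects a a')
    (hp : q.IsValid p) : ∃ o, q.IsOrder o ∧ p <+: o := by
  refine hp.induction_up (P := fun p => ∃ o, q.IsOrder o ∧ p <+: o)
    (fun o ho => ⟨o, ho, List.prefix_rfl⟩) fun p _ hx ih => ?_
  obtain ⟨a, ha⟩ := Query.exists_action hq hx
  obtain ⟨o, ho, hpo⟩ := ih a ha
  exact ⟨o, ho, (List.prefix_append _ _).trans hpo⟩

end Finite

/-! ### Values of prefixes -/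

/-- The largest value of `r` at an order that extends `p`. -/
noncomputable def Query.value (q : Query A) (r : List A → ℝ) (p : List A) : ℝ :=
  sSup (r '' {o | q.IsOrder o ∧ p <+: o})

variable {r : List A → ℝ}

lemma Query.IsOrder.value_eq (ho : q.IsOrder o) : q.value r o = r o := by
  have : {o' | q.IsOrder o' ∧ o <+: o'} = {o} := by
    ext o'
    refine ⟨fun h => (ho.prefix_iff h.1).1 h.2, ?_⟩
    rintro rfl
    exact ⟨ho, List.prefix_rfl⟩
  rw [Query.value, this, Set.image_singleton, csSup_singleton]

variable [Finite A]

lemma Query.finite_image_extensions (q : Query A) (r : List A → ℝ) (p : List A) :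
    (r '' {o | q.IsOrder o ∧ p <+: o}).Finite :=
  (q.finite_isValid.subset fun _ ho => ho.1.isValid).image r

lemma Query.le_value (ho : q.IsOrder o) (hp : p <+: o) : r o ≤ q.value r p :=
  le_csSup (q.finite_image_extensions r p).bddAbove ⟨o, ⟨ho, hp⟩, rfl⟩

lemma Query.IsValid.exists_eq_value (hq : ∀ a a', Relation.ReflTransGen q.Connects a a')
    (hp : q.IsValid p) (r : List A → ℝ) : ∃ o, q.IsOrder o ∧ p <+: o ∧ r o = q.value r p := by
  obtain ⟨o, ho⟩ := hp.exists_isOrder hq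
  obtain ⟨o', ⟨ho', hp'⟩, h⟩ : q.value r p ∈ r '' {o | q.IsOrder o ∧ p <+: o} :=
    Set.Nonempty.csSup_mem ⟨r o, o, ho, rfl⟩ (q.finite_image_extensions r p)
  exact ⟨o', ho', hp', h⟩

lemma Query.IsValid.value_append_le (hq : ∀ a a', Relation.ReflTransGen q.Connects a a')
    (hp : q.IsValid (p ++ [a])) (r : List A → ℝ) : q.value r (p ++ [a]) ≤ q.value r p := by
  obtain ⟨o, ho, hpo, h⟩ := hp.exists_eq_value hq r
  exact h ▸ Query.le_value ho ((List.prefix_append _ _).trans hpo)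

lemma Query.IsValid.exists_value_append_eq (hq : ∀ a a', Relation.ReflTransGen q.Connects a a')
    (hp : q.IsValid p) (hx : ∃ x, x ∉ p) (r : List A → ℝ) :
    ∃ a, q.Action p a ∧ q.value r (p ++ [a]) = q.value r p := by
  obtain ⟨o, ho, hpo, h⟩ := hp.exists_eq_value hq r
  obtain ⟨x, hx⟩ := hx
  obtain ⟨a, ha⟩ := exists_append_prefix hpo (ho.1 x) hx
  exact ⟨a, ho.2 p a ha,
    ((ho.isValid.of_prefix ha).value_append_le hq r).antisymm (h ▸ Query.le_value ho ha)⟩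

lemma Query.isMaxOn_iff_value_nil_le (hq : ∀ a a', Relation.ReflTransGen q.Connects a a') :
    IsMaxOn r {o | q.IsOrder o} o ↔ q.value r [] ≤ r o := by
  refine ⟨fun h => ?_, fun h o' ho' => (Query.le_value ho' List.nil_prefix).trans h⟩
  obtain ⟨o', ho', -, h'⟩ := q.isValid_nil.exists_eq_value hq r
  exact h' ▸ h ho'

lemma isOptimal_iff_isMaxOn {A : Type*} [Fintype A] [DecidableEq A] [Nonempty A] {q : Query A}
    {n b : ℕ} (hn : 1 ≤ n) (hb : 1 ≤ b) {o : List A} :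
    IsOptimal q n b o ↔ q.IsOrder o ∧ IsMaxOn (averageReward q n b) {o | q.IsOrder o} o :=
  and_congr_right fun ho => forall₂_congr fun _ ho' =>
    expectedSteps_le_iff hn hb ho.isValid.nodup ho'.isValid.nodup

end Orders

/-! ### Statistics of the search tree -/

section Statistics

variable {A : Type*} [DecidableEq A] {X : List A → ℕ → ℝ} {sel : ℕ → List A} {t : ℕ} {p : List A}

/-- The reward of episode `t` is recorded at the node `p`: this is the condition under which
`Stats.update` changes the statistics of `p`. -/
def Recorded (X : List A → ℕ → ℝ) (sel : ℕ → List A) (t : ℕ) (p : List A) : Prop :=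
  p <+: sel t ∧ (p.dropLast = [] ∨ 0 < (stats X sel t).count p.dropLast)

lemma count_succ_of_recorded (h : Recorded X sel t p) :
    (stats X sel (t + 1)).count p = (stats X sel t).count p + 1 := if_pos h

lemma count_succ_of_not_recorded (h : ¬Recorded X sel t p) :
    (stats X sel (t + 1)).count p = (stats X sel t).count p := if_neg h

lemma total_succ_of_recorded (h : Recorded X sel t p) :
    (stats X sel (t + 1)).total p = (stats X sel t).total p + episodeReward X sel t := if_pos h

lemma total_succ_of_not_recorded (h : ¬Recorded X sel t p) :
    (stats X sel (t + 1)).total p = (stats X sel t).total p := if_neg h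

lemma recorded_iff_count_succ_ne :
    Recorded X sel t p ↔ (stats X sel (t + 1)).count p ≠ (stats X sel t).count p := by
  refine ⟨fun h => ?_, fun h => by_contra fun hr => h (count_succ_of_not_recorded hr)⟩
  rw [count_succ_of_recorded h]
  exact Nat.succ_ne_self _

open Classical in
lemma count_succ_sub_count (t : ℕ) (p : List A) :
    ((stats X sel (t + 1)).count p - (stats X sel t).count p : ℝ) =
      if Recorded X sel t p then 1 else 0 := by
  split_ifs with h
  · simp [count_succ_of_recorded h]
  · simp [count_succ_of_not_recorded h]

open Classical in
lemma total_succ_sub_total (t : ℕ) (p : List A) :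
    (stats X sel (t + 1)).total p - (stats X sel t).total p =
      if Recorded X sel t p then episodeReward X sel t else 0 := by
  split_ifs with h
  · simp [total_succ_of_recorded h]
  · simp [total_succ_of_not_recorded h]

lemma count_le_count_succ (t : ℕ) (p : List A) :
    (stats X sel t).count p ≤ (stats X sel (t + 1)).count p := by
  by_cases h : Recorded X sel t p
  · exact (count_succ_of_recorded h).ge.trans' (Nat.le_succ _)
  · exact (count_succ_of_not_recorded h).ge

lemma count_succ_le (t : ℕ) (p : List A) :
    (stats X sel (t + 1)).count p ≤ (stats X sel t).count p + 1 := by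
  by_cases h : Recorded X sel t p
  · exact (count_succ_of_recorded h).le
  · exact (count_succ_of_not_recorded h).le.trans (Nat.le_succ _)

lemma count_mono (p : List A) : Monotone fun t => (stats X sel t).count p :=
  monotone_nat_of_le_succ fun t => count_le_count_succ t p

lemma count_nil (t : ℕ) : (stats X sel t).count [] = t := by
  induction t with
  | zero => rfl
  | succ t ih => rw [count_succ_of_recorded ⟨List.nil_prefix, Or.inl rfl⟩, ih]

lemma count_le (t : ℕ) (p : List A) : (stats X sel t).count p ≤ t := by
  induction t with
  | zero => exact le_rfl
  | succ t ih => exact (count_succ_le t p).trans (Nat.succ_le_succ ih)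

lemma eventually_recorded_iff (p : List A) :
    ∀ᶠ t in atTop, (Recorded X sel t p ↔ p <+: sel t) := by
  suffices h : ∀ᶠ t in atTop, (p <+: sel t → Recorded X sel t p) from
    h.mono fun t ht => ⟨And.left, ht⟩
  induction p using List.reverseRecOn with
  | nil => exact Eventually.of_forall fun t h => ⟨h, Or.inl rfl⟩
  | append_singleton p a ih =>
    by_cases hp : ∃ᶠ t in atTop, p <+: sel t
    · obtain ⟨t₁, hpre, hrec⟩ := (hp.and_eventually ih).exists
      have hpos : 0 < (stats X sel (t₁ + 1)).count p := by
        rw [count_succ_of_recorded (hrec hpre)]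
        exact Nat.succ_pos _
      filter_upwards [eventually_ge_atTop (t₁ + 1)] with t ht h
      refine ⟨h, Or.inr ?_⟩
      rw [List.dropLast_concat]
      exact hpos.trans_le (count_mono p ht)
    · filter_upwards [not_frequently.1 hp] with t ht h
      exact (ht ((List.prefix_append _ _).trans h)).elim

/-- The number of executions of order `o` before episode `t`. -/
def executions (sel : ℕ → List A) (o : List A) (t : ℕ) : ℕ := Nat.count (sel · = o) t

lemma executions_succ (sel : ℕ → List A) (o : List A) (t : ℕ) :
    executions sel o (t + 1) = executions sel o t + if sel t = o then 1 else 0 :=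
  Nat.count_succ _ _

lemma executions_eq_card (sel : ℕ → List A) (o : List A) (t : ℕ) :
    executions sel o t = ((Finset.range t).filter fun s => sel s = o).card :=
  Nat.count_eq_card_filter_range _ _

lemma episodeReward_eq (X : List A → ℕ → ℝ) (sel : ℕ → List A) (t : ℕ) :
    episodeReward X sel t = X (sel t) (executions sel (sel t) t) := by
  rw [episodeReward, executions_eq_card]

end Statistics

/-! ### Runs of UCT -/

/-- The sample means of the successive rewards of each order `o` in the search space tend to
`r o`. -/
def HasMeans {A : Type*} (q : Query A) (X : List A → ℕ → ℝ) (r : List A → ℝ) : Prop :=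
  ∀ o, q.IsOrder o →
    Tendsto (fun k : ℕ => (∑ i ∈ Finset.range k, X o i) / k) atTop (𝓝 (r o))

section Run

variable {A : Type*} [DecidableEq A] {q : Query A} {C : ℝ} {X : List A → ℕ → ℝ}
  {sel : ℕ → List A} {p o : List A} {r : List A → ℝ}

lemma IsRun.isOrder (hrun : IsRun q C X sel) (t : ℕ) : q.IsOrder (sel t) := (hrun t).1

lemma IsRun.eventually_recorded_iff_eq (hrun : IsRun q C X sel) (ho : q.IsOrder o) :
    ∀ᶠ t in atTop, (Recorded X sel t o ↔ sel t = o) :=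
  (eventually_recorded_iff o).mono fun t ht => ht.trans (ho.prefix_iff (hrun.isOrder t))

lemma IsRun.count_eq_executions_add (hrun : IsRun q C X sel) (ho : q.IsOrder o) :
    ∃ c : ℝ, ∀ᶠ t in atTop, ((stats X sel t).count o : ℝ) = executions sel o t + c := by
  refine exists_eventually_eq_add_const ?_
  filter_upwards [hrun.eventually_recorded_iff_eq ho] with t ht
  simp [count_succ_sub_count, executions_succ, ht]

lemma IsRun.total_eq_sum_executions_add (hrun : IsRun q C X sel) (ho : q.IsOrder o) :
    ∃ c : ℝ, ∀ᶠ t in atTop, (stats X sel t).total o =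
      ∑ k ∈ Finset.range (executions sel o t), X o k + c := by
  refine exists_eventually_eq_add_const ?_
  filter_upwards [hrun.eventually_recorded_iff_eq ho] with t ht
  rw [total_succ_sub_total, executions_succ]
  simp only [ht]
  split_ifs with h
  · rw [Finset.sum_range_succ, add_sub_cancel_left, episodeReward_eq, h]
  · rw [add_zero, sub_self]

lemma IsRun.tendsto_mean_of_isOrder (hrun : IsRun q C X sel) (hr : HasMeans q X r)
    (ho : q.IsOrder o) (hcount : Tendsto (fun t => (stats X sel t).count o) atTop atTop) :
    Tendsto (fun t => (stats X sel t).mean o) atTop (𝓝 (r o)) := by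
  obtain ⟨c, hc⟩ := hrun.count_eq_executions_add ho
  obtain ⟨d, hd⟩ := hrun.total_eq_sum_executions_add ho
  have hexec : Tendsto (executions sel o) atTop atTop := by
    rw [← tendsto_natCast_atTop_iff (R := ℝ)] at hcount ⊢
    exact (tendsto_atTop_add_const_right _ (-c) hcount).congr' (hc.mono fun t ht => by
      rw [ht, add_neg_cancel_right])
  have hsum : (fun t => ∑ k ∈ Finset.range (executions sel o t), X o k -
      r o * executions sel o t) =o[atTop] fun t => (executions sel o t : ℝ) :=
    (tendsto_div_iff_isLittleO (eventually_natCast_ne_zero hexec)).1 ((hr o ho).comp hexec)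
  have hbig : (fun t => (executions sel o t : ℝ)) =O[atTop]
      fun t => ((stats X sel t).count o : ℝ) :=
    ((isBigO_refl _ _).sub (isLittleO_const_natCast hcount c).isBigO).congr'
      (hc.mono fun t ht => by simp only [ht, add_sub_cancel_right]) .rfl
  refine (tendsto_div_iff_isLittleO (eventually_natCast_ne_zero hcount)).2 <|
    ((hsum.trans_isBigO hbig).add (isLittleO_const_natCast hcount (d - r o * c))).congr' ?_ .rfl
  filter_upwards [hc, hd] with t hc hd
  rw [hc, hd]
  ring

lemma IsRun.ucb_le_of_recorded (hrun : IsRun q C X sel) {t : ℕ} {a a' : A}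
    (hrec : Recorded X sel t (p ++ [a])) (hne : (stats X sel t).count (p ++ [a]) ≠ 0)
    (ha' : q.Action p a') : (stats X sel t).count (p ++ [a']) ≠ 0 ∧
      (stats X sel t).ucb C p a' ≤ (stats X sel t).ucb C p a := by
  obtain ⟨-, hnew, hmax⟩ := (hrun t).2 p a hrec.1
  have hall : ∀ a', q.Action p a' → (stats X sel t).count (p ++ [a']) ≠ 0 :=
    fun a' ha' h0 => hne (hnew ⟨a', ha', h0⟩)
  exact ⟨hall a' ha', hmax hall a' ha'⟩

end Run

section Convergence

variable {A : Type*} [Finite A] [DecidableEq A] {q : Query A} {C : ℝ} {X : List A → ℕ → ℝ}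
  {sel : ℕ → List A} {p o : List A} {r : List A → ℝ}

open Classical in
lemma IsRun.eventually_sum_actions (hrun : IsRun q C X sel) (hx : ∃ x, x ∉ p) (y : ℕ → ℝ) :
    ∀ᶠ t in atTop, (if Recorded X sel t p then y t else 0) =
      ∑ a ∈ q.actions p, if Recorded X sel t (p ++ [a]) then y t else 0 := by
  obtain ⟨x, hx⟩ := hx
  have hchildren : ∀ᶠ t in atTop, ∀ a, (Recorded X sel t (p ++ [a]) ↔ p ++ [a] <+: sel t) :=
    eventually_all.2 fun a => eventually_recorded_iff (p ++ [a])
  filter_upwards [eventually_recorded_iff (X := X) (sel := sel) p, hchildren] with t hrec hrec'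
  simp only [hrec, hrec']
  by_cases hp : p <+: sel t
  · obtain ⟨a, ha⟩ := exists_append_prefix hp ((hrun.isOrder t).1 x) hx
    rw [if_pos hp, Finset.sum_eq_single a, if_pos ha]
    · exact fun a' _ hne => if_neg fun ha' => hne (append_prefix_unique ha' ha)
    · exact fun hn => (hn (Query.mem_actions.2 ((hrun.isOrder t).2 p a ha))).elim
  · rw [if_neg hp]
    exact (Finset.sum_eq_zero fun a _ => if_neg fun ha =>
      hp ((List.prefix_append _ _).trans ha)).symm

lemma IsRun.count_eq_sum_actions_add (hrun : IsRun q C X sel) (hx : ∃ x, x ∉ p) :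
    ∃ c : ℝ, ∀ᶠ t in atTop, ((stats X sel t).count p : ℝ) =
      ∑ a ∈ q.actions p, ((stats X sel t).count (p ++ [a]) : ℝ) + c := by
  refine exists_eventually_eq_add_const ?_
  simpa only [← Finset.sum_sub_distrib, count_succ_sub_count] using
    hrun.eventually_sum_actions hx fun _ => 1

lemma IsRun.total_eq_sum_actions_add (hrun : IsRun q C X sel) (hx : ∃ x, x ∉ p) :
    ∃ d : ℝ, ∀ᶠ t in atTop, (stats X sel t).total p =
      ∑ a ∈ q.actions p, (stats X sel t).total (p ++ [a]) + d := by
  refine exists_eventually_eq_add_const ?_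
  simpa only [← Finset.sum_sub_distrib, total_succ_sub_total] using
    hrun.eventually_sum_actions hx (episodeReward X sel)

lemma IsRun.ucbProcess (hrun : IsRun q C X sel) (hx : ∃ x, x ∉ p)
    (hp : Tendsto (fun t => (stats X sel t).count p) atTop atTop) {V : A → ℝ}
    (hmean : ∀ a, q.Action p a → Tendsto (fun t => (stats X sel t).count (p ++ [a])) atTop atTop →
      Tendsto (fun t => (stats X sel t).mean (p ++ [a])) atTop (𝓝 (V a))) :
    UCBProcess (q.actions p) C (fun t => (stats X sel t).count p)
      (fun t => (stats X sel t).total p) (fun a t => (stats X sel t).count (p ++ [a]))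
      (fun a t => (stats X sel t).total (p ++ [a])) V where
  mono _ _ := count_mono _
  step _ _ t := count_succ_le t _
  frozen _ _ _ h := total_succ_of_not_recorded fun hrec => recorded_iff_count_succ_ne.1 hrec h
  mono_parent := count_mono _
  tendsto_parent := hp
  count_sum := hrun.count_eq_sum_actions_add hx
  total_sum := hrun.total_eq_sum_actions_add hx
  rule _ _ _ hlt hne _ ha' :=
    hrun.ucb_le_of_recorded (recorded_iff_count_succ_ne.2 hlt.ne') hne (Query.mem_actions.1 ha')
  tendsto_mean a ha := hmean a (Query.mem_actions.1 ha)

variable (hq : ∀ a a', Relation.ReflTransGen q.Connects a a') (hC : 0 < C)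
  (hrun : IsRun q C X sel) (hr : HasMeans q X r)

include hq hC hrun hr

lemma tendsto_mean_of_tendsto_count (hp : q.IsValid p)
    (hcount : Tendsto (fun t => (stats X sel t).count p) atTop atTop) :
    Tendsto (fun t => (stats X sel t).mean p) atTop (𝓝 (q.value r p)) := by
  revert hcount
  refine hp.induction_up (P := fun p => Tendsto (fun t => (stats X sel t).count p) atTop atTop →
      Tendsto (fun t => (stats X sel t).mean p) atTop (𝓝 (q.value r p)))
    (fun o ho hcount => ?_) fun p hp hx ih hcount => ?_
  · rw [ho.value_eq]
    exact hrun.tendsto_mean_of_isOrder hr ho hcount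
  · obtain ⟨a, ha, hav⟩ := hp.exists_value_append_eq hq hx r
    rw [← hav]
    refine (hrun.ucbProcess hx hcount ih).tendsto_mean_parent hC (Query.mem_actions.2 ha)
      fun a' ha' => ?_
    exact hav ▸ (hp.append (Query.mem_actions.1 ha')).value_append_le hq r

lemma ucbProcess_of_tendsto_count (hp : q.IsValid p) (hx : ∃ x, x ∉ p)
    (hcount : Tendsto (fun t => (stats X sel t).count p) atTop atTop) :
    UCBProcess (q.actions p) C (fun t => (stats X sel t).count p)
      (fun t => (stats X sel t).total p) (fun a t => (stats X sel t).count (p ++ [a]))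
      (fun a t => (stats X sel t).total (p ++ [a])) (fun a => q.value r (p ++ [a])) :=
  hrun.ucbProcess hx hcount fun _ ha =>
    tendsto_mean_of_tendsto_count hq hC hrun hr (hp.append ha)

lemma tendsto_count (hp : q.IsValid p) :
    Tendsto (fun t => (stats X sel t).count p) atTop atTop := by
  induction p using List.reverseRecOn with
  | nil => exact tendsto_id.congr fun t => (count_nil t).symm
  | append_singleton p a ih =>
    have ha := hp p a List.prefix_rfl
    have hp' := hp.of_prefix (List.prefix_append p [a])
    exact (ucbProcess_of_tendsto_count hq hC hrun hr hp' ⟨a, ha.1⟩ (ih hp')).tendsto_count hC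
      (Query.mem_actions.2 ha)

lemma tendsto_mean (hp : q.IsValid p) :
    Tendsto (fun t => (stats X sel t).mean p) atTop (𝓝 (q.value r p)) :=
  tendsto_mean_of_tendsto_count hq hC hrun hr hp (tendsto_count hq hC hrun hr hp)

lemma isLittleO_count_of_value_lt (hp : q.IsValid p) (hlt : q.value r p < q.value r []) :
    (fun t => ((stats X sel t).count p : ℝ)) =o[atTop] fun t => (t : ℝ) := by
  induction p using List.reverseRecOn with
  | nil => exact (lt_irrefl _ hlt).elim
  | append_singleton p a ih =>
    have ha := hp p a List.prefix_rfl
    have hp' := hp.of_prefix (List.prefix_append p [a])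
    have hproc := ucbProcess_of_tendsto_count hq hC hrun hr hp' ⟨a, ha.1⟩
      (tendsto_count hq hC hrun hr hp')
    rcases (hp.value_append_le hq r).lt_or_eq with hlt' | heq
    · obtain ⟨b, hb, hbv⟩ := hp'.exists_value_append_eq hq ⟨a, ha.1⟩ r
      exact (hproc.isLittleO_count hC (Query.mem_actions.2 ha) (Query.mem_actions.2 hb)
        (hlt'.trans_eq hbv.symm)).trans_isBigO (.of_norm_le fun t => by simpa using count_le t p)
    · exact (hproc.isBigO_count (Query.mem_actions.2 ha)).trans_isLittleO (ih hp' (heq ▸ hlt))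

lemma isLittleO_executions (ho : q.IsOrder o) (hlt : r o < q.value r []) :
    (fun t => (executions sel o t : ℝ)) =o[atTop] fun t => (t : ℝ) := by
  obtain ⟨c, hc⟩ := hrun.count_eq_executions_add ho
  refine ((isLittleO_count_of_value_lt hq hC hrun hr ho.isValid (ho.value_eq.trans_lt hlt)).sub
    (isLittleO_const_natCast tendsto_id c)).congr' (hc.mono fun t ht => ?_) .rfl
  simp only [ht, add_sub_cancel_right]

open Classical in
lemma isLittleO_card_not_isMaxOn :
    (fun T => (((Finset.range T).filter fun t =>
      ¬IsMaxOn r {o | q.IsOrder o} (sel t)).card : ℝ)) =o[atTop] fun T => (T : ℝ) := by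
  have hfin : {o | q.IsOrder o ∧ r o < q.value r []}.Finite :=
    q.finite_isValid.subset fun _ ho => ho.1.isValid
  have hsum : (fun T => ∑ o ∈ hfin.toFinset, (executions sel o T : ℝ)) =o[atTop]
      fun T => (T : ℝ) :=
    IsLittleO.fun_sum fun o ho =>
      isLittleO_executions hq hC hrun hr (hfin.mem_toFinset.1 ho).1 (hfin.mem_toFinset.1 ho).2
  refine IsBigO.trans_isLittleO (.of_norm_le fun T => ?_) hsum
  rw [Real.norm_natCast]
  norm_cast
  simp only [executions_eq_card]
  refine (Finset.card_le_card fun t ht => ?_).trans Finset.card_biUnion_le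
  rw [Finset.mem_filter, Query.isMaxOn_iff_value_nil_le hq, not_le] at ht
  exact Finset.mem_biUnion.2 ⟨sel t, hfin.mem_toFinset.2 ⟨hrun.isOrder t, ht.2⟩,
    Finset.mem_filter.2 ⟨ht.1, rfl⟩⟩

open Classical in
lemma tendsto_fraction_isMaxOn :
    Tendsto (fun T : ℕ => (((Finset.range T).filter fun t =>
      IsMaxOn r {o | q.IsOrder o} (sel t)).card : ℝ) / T) atTop (𝓝 1) := by
  refine (tendsto_div_iff_isLittleO (eventually_natCast_ne_zero tendsto_id)).2 <|
    (isLittleO_card_not_isMaxOn hq hC hrun hr).neg_left.congr_left fun T => ?_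
  have hcard := Finset.card_filter_add_card_filter_not (s := Finset.range T)
    fun t => IsMaxOn r {o | q.IsOrder o} (sel t)
  rw [Finset.card_range] at hcard
  rw [one_mul, id, eq_sub_iff_add_eq, neg_add_eq_sub, sub_eq_iff_eq_add]
  exact_mod_cast hcard.symm

lemma eventually_value_le_of_mean_le :
    ∀ᶠ T in atTop, ∀ p, q.IsValid p → ∀ a, q.Action p a → ∀ b, q.Action p b →
      (stats X sel T).mean (p ++ [a]) ≤ (stats X sel T).mean (p ++ [b]) →
        q.value r (p ++ [a]) ≤ q.value r (p ++ [b]) := by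
  refine (eventually_all_finite q.finite_isValid).2 fun p hp =>
    eventually_all.2 fun a => eventually_imp_distrib_left.2 fun ha =>
    eventually_all.2 fun b => eventually_imp_distrib_left.2 fun hb => ?_
  have hp : q.IsValid p := hp
  rcases le_or_gt (q.value r (p ++ [a])) (q.value r (p ++ [b])) with hle | hlt
  · exact Eventually.of_forall fun _ _ => hle
  · filter_upwards [(tendsto_mean hq hC hrun hr (hp.append hb)).eventually_lt
      (tendsto_mean hq hC hrun hr (hp.append ha)) hlt] with T hT hle
    exact (hT.not_ge hle).elim

end Convergence

lemma IsGreedy.isMaxOn {A : Type*} [Finite A] {q : Query A} {r : List A → ℝ} {S : Stats A}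
    {o : List A} (hq : ∀ a a', Relation.ReflTransGen q.Connects a a')
    (hS : ∀ p, q.IsValid p → ∀ a, q.Action p a → ∀ b,
      q.Action p b → S.mean (p ++ [a]) ≤ S.mean (p ++ [b]) →
        q.value r (p ++ [a]) ≤ q.value r (p ++ [b]))
    (ho : IsGreedy q S o) : IsMaxOn r {o | q.IsOrder o} o := by
  have hval : ∀ p, p <+: o → q.value r [] ≤ q.value r p := by
    intro p
    induction p using List.reverseRecOn with
    | nil => exact fun _ => le_rfl
    | append_singleton p a ih =>
      intro hpa
      have ha := ho.1.2 p a hpa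
      have hpo := (List.prefix_append p [a]).trans hpa
      have hp := ho.1.isValid.of_prefix hpo
      obtain ⟨b, hb, hbv⟩ := hp.exists_value_append_eq hq ⟨a, ha.1⟩ r
      calc q.value r [] ≤ q.value r p := ih hpo
        _ = q.value r (p ++ [b]) := hbv.symm
        _ ≤ q.value r (p ++ [a]) := hS p hp b hb a ha (ho.2 p a hpa b hb)
  rw [Query.isMaxOn_iff_value_nil_le hq, ← ho.1.value_eq (r := r)]
  exact hval o List.prefix_rfl

lemma ae_hasMeans {A Ω : Type*} [Finite A] [MeasurableSpace Ω] {μ : Measure Ω} {q : Query A}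
    {r : List A → ℝ} {X : List A → ℕ → Ω → ℝ}
    (hindep : ∀ o, q.IsOrder o → Pairwise fun i j => X o i ⟂ᵢ[μ] X o j)
    (hident : ∀ o, q.IsOrder o → ∀ k, IdentDistrib (X o k) (X o 0) μ μ)
    (hint : ∀ o, q.IsOrder o → Integrable (X o 0) μ)
    (hmean : ∀ o, q.IsOrder o → ∫ ω, X o 0 ω ∂μ = r o) :
    ∀ᵐ ω ∂μ, HasMeans q (fun o k => X o k ω) r := by
  simp only [HasMeans, ae_all_iff]
  intro o ho
  rw [← hmean o ho]
  exact strong_law_ae_real (X o) (hint o ho) (hindep o ho) (hident o ho)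

end Adopt

open Classical in
theorem mainTheorem2_general {A : Type*} [Fintype A] [DecidableEq A] [Nonempty A]
    {q : Adopt.Query A} (hq : ∀ a a', Relation.ReflTransGen q.Connects a a')
    {n b : ℕ} (hn : 1 ≤ n) (hb : 1 ≤ b) {C : ℝ} (hC : 0 < C)
    {X : List A → ℕ → ℝ} {sel : ℕ → List A} (hrun : Adopt.IsRun q C X sel)
    (hX : Adopt.HasMeans q X (Adopt.averageReward q n b)) :
    Tendsto (fun T : ℕ =>
        (((Finset.range T).filter (fun t => Adopt.IsOptimal q n b (sel t))).card : ℝ) / T)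
      atTop (𝓝 1) ∧
    ∀ᶠ T : ℕ in atTop, ∀ o : List A,
      Adopt.IsGreedy q (Adopt.stats X sel T) o → Adopt.IsOptimal q n b o := by
  simp only [Adopt.isOptimal_iff_isMaxOn hn hb]
  refine ⟨?_, ?_⟩
  · simpa only [hrun.isOrder, true_and] using Adopt.tendsto_fraction_isMaxOn hq hC hrun hX
  · filter_upwards [Adopt.eventually_value_le_of_mean_le hq hC hrun hX] with T hT o ho
    exact ⟨ho.1, ho.isMaxOn hq hT⟩

open Classical in
theorem mainTheorem2 {A : Type*} [Fintype A] [DecidableEq A] [Nonempty A]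
    (q : Adopt.Query A) (hq : ∀ a a', Relation.ReflTransGen q.Connects a a')
    (n b : ℕ) (hn : 1 ≤ n) (hb : 1 ≤ b) (C : ℝ) (hC : 0 < C)
    {Ω : Type*} [MeasurableSpace Ω] (μ : Measure Ω) [IsProbabilityMeasure μ]
    (X : List A → ℕ → Ω → ℝ)
    (hX_indep : ∀ o, q.IsOrder o → iIndepFun (X o) μ)
    (hX_ident : ∀ o, q.IsOrder o → ∀ k, IdentDistrib (X o k) (X o 0) μ μ)
    (hX_range : ∀ o, q.IsOrder o → ∀ k, ∀ᵐ ω ∂μ, X o k ω ∈ Set.Icc (0 : ℝ) 1)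
    (hX_mean : ∀ o, q.IsOrder o → ∫ ω, X o 0 ω ∂μ = Adopt.averageReward q n b o)
    (sel : ℕ → Ω → List A)
    (hsel : ∀ᵐ ω ∂μ, Adopt.IsRun q C (fun o k => X o k ω) (fun t => sel t ω)) :
    ∀ᵐ ω ∂μ,
      Tendsto (fun T : ℕ =>
          (((Finset.range T).filter (fun t => Adopt.IsOptimal q n b (sel t ω))).card : ℝ) / T)
        atTop (𝓝 1) ∧
      ∀ᶠ T : ℕ in atTop, ∀ o : List A,
        Adopt.IsGreedy q (Adopt.stats (fun o k => X o k ω) (fun t => sel t ω) T) o →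
          Adopt.IsOptimal q n b o := by
  have hint (o : List A) (ho : q.IsOrder o) : Integrable (X o 0) μ :=
    .of_mem_Icc 0 1 (hX_ident o ho 0).aemeasurable_fst (hX_range o ho 0)
  have hmeans := Adopt.ae_hasMeans (fun o ho i j h => (hX_indep o ho).indepFun h) hX_ident hint
    hX_mean
  filter_upwards [hsel, hmeans] with ω hrun hmeans
  exact mainTheorem2_general hq hn hb hC hrun hmeans
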